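/- Let $A$ be a $C^*$-algebra, let $M$ be a correspondence over $A$ (a right Hilbert $A$-module with a left action of $A$ given by a $*$-homomorphism $A\to\mathcal L(M)$), let $Y$ be a right Hilbert $A$-module, and let $T:Y\to Y\otimes_A M$ be an inner-product preserving adjointable map. All tensor products are internal tensor products: $X\otimes_A M$ is the completion of the algebraic tensor product in the inner product $\langle x\otimes m,y\otimes n\rangle=\langle\langle y,x\rangle\cdot m,n\rangle$. Write $Y\otimes_A M^{\otimes 0}=Y$, $Y\otimes_A M^{\otimes(k+1)}=(Y\otimes_A M^{\otimes k})\otimes_A M$, and $T_k:=T\otimes\mathrm{id}_k:Y\otimes_A M^{\otimes k}\to Y\otimes_A M^{\otimes(k+1)}$. For a Hilbert-module isomorphism $U:X\to X\otimes_A M$ let $U^k:X\to X\otimes_A M^{\otimes k}$ be the isomorphisms with $U^0=\mathrm{id}$ and $U^{k+1}=(U\otimes\mathrm{id}_k)\circ U^k$, and let $U^{-k}$ be the inverse of $U^k$. For a closed submodule $V\subseteq X$, $V\otimes_A M^{\otimes k}$ is regarded as a closed submodule of $X\otimes_A M^{\otimes k}$. The direct limit of a sequence $(X_k,T_k)$ of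 Hilbert $A$-modules and inner-product preserving maps is a Hilbert $A$-module $X_\infty$ with inner-product preserving maps $\iota^k:X_k\to X_\infty$ such that $\iota^{k+1}\circ T_k=\iota^k$ and such that, whenever $S_k:X_k\to Z$ are bounded $A$-module homomorphisms into a Hilbert $A$-module $Z$ with $S_{k+1}\circ T_k=S_k$ and $\|S_k\|\le C$ for all $k$, there is a unique bounded $A$-module homomorphism $S_\infty:X_\infty\to Z$ with $\|S_\infty\|\le C$ and $S_\infty\circ\iota^k=S_k$ for all $k$. Then the direct limit $(Y_\infty,\iota^k)=\varinjlim(Y\otimes_A M^{\otimes k},T_k)$ exists, and the following hold. (a) There is a Hilbert-module isomorphism $R$ of $Y_\infty$ onto $Y_\infty\otimes_A M$ such that $R\circ\iota^{k+1}=\iota^k\otimes\mathrm{id}$ for all $k\ge 0$. The closed submodules $Y_k:=\iota^k(Y\otimes_A M^{\otimes k})$ of $Y_\infty$ satisfy: (i) $Y_0$ is an (orthogonally) complemented $A$-submodule of $Y_\infty$; (ii) $Y_k=R^{-k}(Y_0\otimes_A M^{\otimes k})$ for $k\ge 0$; (iii) $Y_k$ is a complemented submodule of $Y_{k+1}$ for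 $k\ge 0$; (iv) $\bigcup_{k\ge 0}Y_k$ is dense in $Y_\infty$. (b) Suppose that $X$ is a Hilbert $A$-module, $D:X\to X\otimes_A M$ is a Hilbert-module isomorphism, and $Q_0:Y\to X$ is an inner-product preserving map such that $D\circ Q_0=(Q_0\otimes\mathrm{id})\circ T$. Then there is an inner-product preserving map $Q:Y_\infty\to X$ such that $Q\circ\iota^0=Q_0$ and $D\circ Q=(Q\otimes\mathrm{id})\circ R$. The submodules $V_k:=Q(Y_k)$ of the closed submodule $Q(Y_\infty)$ of $X$ satisfy $$V_k=D^{-k}\circ(Q_0\otimes\mathrm{id}_k)(Y\otimes_A M^{\otimes k})\qquad(k\ge 0),$$ and moreover: $V_0$ is complemented in $Q(Y_\infty)$; $V_k=D^{-k}(V_0\otimes_A M^{\otimes k})$ for $k\ge 0$; $V_k$ is complemented in $V_{k+1}$ for $k\ge 0$; and $\bigcup_{k\ge 0}V_k$ is dense in $Q(Y_\infty)$. -/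

import Mathlib

universe u v

noncomputable section

open scoped TensorProduct
open MulOpposite

/-- A right Hilbert module over the C⋆-algebra `A`: a complete Hilbert C⋆-module. Mathlib's
`CStarModule B E` has `⟪x, b • y⟫ = b * ⟪x, y⟫`, so a *right* Hilbert `A`-module, in which
`⟪x, y · a⟫ = ⟪x, y⟫ * a`, is a `CStarModule` over `Aᵐᵒᵖ` (with `y · a = op a • y`). -/
structure HilbertModule (A : Type u) [NonUnitalCStarAlgebra A] [PartialOrder A] where
  carrier : Type v
  [normedAddCommGroup : NormedAddCommGroup carrier]
  [normedSpace : NormedSpace ℂ carrier]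
  [completeSpace : CompleteSpace carrier]
  [rightAction : SMul Aᵐᵒᵖ carrier]
  [cstarModule : CStarModule Aᵐᵒᵖ carrier]

namespace HilbertModule

variable {A : Type u} [NonUnitalCStarAlgebra A] [PartialOrder A]

instance : CoeSort (HilbertModule.{u, v} A) (Type v) := ⟨carrier⟩

attribute [instance] normedAddCommGroup normedSpace completeSpace rightAction cstarModule

variable {X : HilbertModule.{u, v} A}

/-- The `A`-valued inner product `⟨x, y⟩`, linear in the second variable. -/
def ip (x y : X) : A := unop (inner Aᵐᵒᵖ x y)

/-- The right action `x · a`. -/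
def ract (x : X) (a : A) : X := op a • x

lemma ip_add_right (x y z : X) : ip x (y + z) = ip x y + ip x z := by simp [ip]
lemma ip_add_left (x y z : X) : ip (x + y) z = ip x z + ip y z := by simp [ip]
lemma ip_sub_right (x y z : X) : ip x (y - z) = ip x y - ip x z := by simp [ip]
lemma ip_sub_left (x y z : X) : ip (x - y) z = ip x z - ip y z := by simp [ip]
lemma ip_smul_right (c : ℂ) (x y : X) : ip x (c • y) = c • ip x y := by simp [ip]
lemma ip_smul_left (c : ℂ) (x y : X) : ip (c • x) y = star c • ip x y := by simp [ip]
lemma ip_ract_right (x y : X) (a : A) : ip x (ract y a) = ip x y * a := by simp [ip, ract]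
lemma star_ip (x y : X) : star (ip x y) = ip y x := by
  rw [ip, ip, ← CStarModule.star_inner (A := Aᵐᵒᵖ) x y]; rfl
lemma ip_ract_left (x y : X) (a : A) : ip (ract x a) y = star a * ip x y := by
  rw [← star_ip, ip_ract_right, star_mul, star_ip]
lemma ip_self_nonneg (x : X) : 0 ≤ ip x x := CStarModule.inner_self_nonneg (A := Aᵐᵒᵖ) (x := x)
lemma ip_self_eq_zero (x : X) : ip x x = 0 ↔ x = 0 := by
  rw [ip, unop_eq_zero_iff, CStarModule.inner_self]
lemma norm_eq (x : X) : ‖x‖ = √‖ip x x‖ :=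
  CStarModule.norm_eq_sqrt_norm_inner_self (A := Aᵐᵒᵖ) x

lemma ip_sum_right {κ : Type*} (s : Finset κ) (x : X) (f : κ → X) :
    ip x (∑ i ∈ s, f i) = ∑ i ∈ s, ip x (f i) := by
  simp [ip]
lemma ip_sum_left {κ : Type*} (s : Finset κ) (x : X) (f : κ → X) :
    ip (∑ i ∈ s, f i) x = ∑ i ∈ s, ip (f i) x := by
  simp [ip]

lemma ext_ip {x y : X} (h : ∀ z : X, ip z x = ip z y) : x = y := by
  rw [← sub_eq_zero, ← ip_self_eq_zero, ip_sub_right, h, sub_self]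

lemma ract_add (x y : X) (a : A) : ract (x + y) a = ract x a + ract y a :=
  ext_ip fun z => by simp only [ip_ract_right, ip_add_right, add_mul]
lemma ract_smul (c : ℂ) (x : X) (a : A) : ract (c • x) a = c • ract x a :=
  ext_ip fun z => by simp only [ip_ract_right, ip_smul_right, smul_mul_assoc]

end HilbertModule

open HilbertModule

/-- A correspondence over `A`: a right Hilbert `A`-module with a left action of `A` given by a
`*`-homomorphism of `A` into the adjointable operators. -/
structure Correspondence (A : Type u) [NonUnitalCStarAlgebra A] [PartialOrder A]
    extends HilbertModule.{u, v} A where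
  left : A →ₙₐ[ℂ] (carrier →L[ℂ] carrier)
  ip_left : ∀ (a : A) (m n : carrier),
    HilbertModule.ip (X := toHilbertModule) (left a m) n
      = HilbertModule.ip (X := toHilbertModule) m (left (star a) n)

section Gram

variable {A : Type u} [NonUnitalCStarAlgebra A] [PartialOrder A] [StarOrderedRing A]

lemma exists_posPart_negPart {B : Type*} [NonUnitalCStarAlgebra B] [PartialOrder B]
    [StarOrderedRing B] (g : B) (hg : IsSelfAdjoint g) :
    ∃ c d : B, g = star c * c - star d * d ∧ star c * c * (star d * d) = 0 := by
  obtain ⟨c, hc⟩ := CStarAlgebra.nonneg_iff_eq_star_mul_self.mp (CFC.posPart_nonneg g)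
  obtain ⟨d, hd⟩ := CStarAlgebra.nonneg_iff_eq_star_mul_self.mp (CFC.negPart_nonneg g)
  refine ⟨c, d, ?_, ?_⟩
  · rw [← hc, ← hd, CFC.posPart_sub_negPart g hg]
  · rw [← hc, ← hd, CFC.posPart_mul_negPart g]

/-- The Gram matrix of a finite family in a Hilbert module has the form `b⋆ b`. -/
lemma HilbertModule.exists_gram {X : HilbertModule.{u, v} A} {κ : Type} [Fintype κ] (x : κ → X) :
    ∃ b : κ → κ → A, ∀ i j, ip (x i) (x j) = ∑ k, star (b k i) * b k j := by
  classical
  let G : CStarMatrix κ κ A := CStarMatrix.ofMatrix (Matrix.of fun i j => ip (x i) (x j))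
  have hG : ∀ i j, G i j = ip (x i) (x j) := fun _ _ => rfl
  have hsa : IsSelfAdjoint G := by
    ext i j
    simp [CStarMatrix.star_apply, hG, star_ip]
  obtain ⟨c, d, hPN, hPN0⟩ := exists_posPart_negPart G hsa
  obtain ⟨N, hd⟩ : ∃ N, N = star d * d := ⟨_, rfl⟩
  rw [← hd] at hPN hPN0
  have hBsa : star N = N := by rw [hd, star_mul, star_star]
  have h1 : star N * G * N = -(star (d * N) * (d * N)) := by
    have : G * N = -(N * N) := by rw [hPN, sub_mul, hPN0, zero_sub]
    rw [star_mul, mul_assoc, this, hBsa, mul_assoc, ← mul_assoc (star d), ← hd, mul_neg]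
  have h2 : ∀ k, (star N * G * N) k k
      = ip (∑ i, ract (x i) (N i k)) (∑ i, ract (x i) (N i k)) := by
    intro k
    simp only [CStarMatrix.mul_apply, CStarMatrix.star_apply, ip_sum_left, ip_sum_right,
      ip_ract_left, ip_ract_right, hG, Finset.sum_mul, mul_assoc]
  have h3 : ∀ k, (star (d * N) * (d * N)) k k = ∑ i, star ((d * N) i k) * (d * N) i k := by
    intro k
    simp only [CStarMatrix.mul_apply, CStarMatrix.star_apply]
  have h4 : d * N = 0 := by
    ext i k
    have e : ∑ i, star ((d * N) i k) * (d * N) i k = 0 := by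
      refine le_antisymm ?_ (Finset.sum_nonneg fun i _ => star_mul_self_nonneg _)
      have := ip_self_nonneg (∑ i, ract (x i) (N i k))
      rw [← h2, h1, CStarMatrix.neg_apply, h3] at this
      exact neg_nonneg.mp this
    have := (Finset.sum_eq_zero_iff_of_nonneg
      (fun i _ => star_mul_self_nonneg ((d * N) i k))).mp e i (Finset.mem_univ _)
    simpa using (CStarRing.star_mul_self_eq_zero_iff _).mp this
  have h5 : N = 0 := by
    rw [← CStarRing.star_mul_self_eq_zero_iff, hBsa]
    nth_rewrite 1 [hd]
    rw [mul_assoc, h4, mul_zero]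
  have hc : G = star c * c := by rw [hPN, h5, sub_zero]
  refine ⟨fun i j => c i j, fun i j => ?_⟩
  rw [← hG, hc]
  simp only [CStarMatrix.mul_apply, CStarMatrix.star_apply]

end Gram

/-- An `A`-valued semi-inner product on a complex vector space with a right action of `A`. -/
structure PreHilbert (A : Type u) [NonUnitalCStarAlgebra A] [PartialOrder A]
    (E : Type v) [AddCommGroup E] [Module ℂ E] where
  form : E → E → A
  act : A → E →ₗ[ℂ] E
  form_add_right : ∀ x y z, form x (y + z) = form x y + form x z
  form_smul_right : ∀ (c : ℂ) x y, form x (c • y) = c • form x y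
  star_form : ∀ x y, star (form x y) = form y x
  form_self_nonneg : ∀ x, 0 ≤ form x x
  form_act : ∀ a x y, form x (act a y) = form x y * a

namespace PreHilbert

variable {A : Type u} [NonUnitalCStarAlgebra A] [PartialOrder A]
  {E : Type v} [AddCommGroup E] [Module ℂ E] (P : PreHilbert A E)

lemma form_add_left (x y z : E) : P.form (x + y) z = P.form x z + P.form y z := by
  rw [← P.star_form, P.form_add_right, star_add, P.star_form, P.star_form]

lemma form_smul_left (c : ℂ) (x y : E) : P.form (c • x) y = star c • P.form x y := by
  rw [← P.star_form, P.form_smul_right, star_smul, P.star_form]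

lemma form_act_left (a : A) (x y : E) : P.form (P.act a x) y = star a * P.form x y := by
  rw [← P.star_form, P.form_act, star_mul, P.star_form]

lemma form_neg_right (x y : E) : P.form x (-y) = -P.form x y := by
  rw [← neg_one_smul ℂ y, P.form_smul_right, neg_one_smul]

lemma form_sub_right (x y z : E) : P.form x (y - z) = P.form x y - P.form x z := by
  rw [sub_eq_add_neg, P.form_add_right, P.form_neg_right, sub_eq_add_neg]

lemma form_sub_left (x y z : E) : P.form (x - y) z = P.form x z - P.form y z := by
  rw [← P.star_form, P.form_sub_right, star_sub, P.star_form, P.star_form]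

lemma form_zero_right (x : E) : P.form x 0 = 0 := by
  have := P.form_smul_right 0 x 0
  simpa using this

lemma form_zero_left (x : E) : P.form 0 x = 0 := by
  rw [← P.star_form, P.form_zero_right, star_zero]

/-- The seminorm `‖⟨x, x⟩‖^{1/2}`. -/
def nrm (x : E) : ℝ := √‖P.form x x‖

lemma nrm_sq (x : E) : P.nrm x ^ 2 = ‖P.form x x‖ := Real.sq_sqrt (norm_nonneg _)

lemma nrm_nonneg (x : E) : 0 ≤ P.nrm x := Real.sqrt_nonneg _

lemma nrm_smul (c : ℂ) (x : E) : P.nrm (c • x) = ‖c‖ * P.nrm x := by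
  rw [nrm, nrm, form_smul_left, form_smul_right, norm_smul, norm_smul, norm_star,
    ← mul_assoc, Real.sqrt_mul (by positivity), Real.sqrt_mul_self (norm_nonneg _)]

lemma nrm_act (a : A) (x : E) : P.nrm (P.act a x) ≤ ‖a‖ * P.nrm x := by
  refine le_of_sq_le_sq ?_ (mul_nonneg (norm_nonneg _) (P.nrm_nonneg x))
  rw [mul_pow, nrm_sq, nrm_sq, form_act, form_act_left]
  calc ‖star a * P.form x x * a‖ ≤ ‖star a‖ * ‖P.form x x‖ * ‖a‖ :=
        (norm_mul_le _ _).trans (mul_le_mul_of_nonneg_right (norm_mul_le _ _) (norm_nonneg _))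
    _ = ‖a‖ ^ 2 * ‖P.form x x‖ := by rw [norm_star]; ring

/-- A copy of `E`, to carry the seminorm. -/
def Space (_P : PreHilbert A E) : Type v := E

instance : AddCommGroup P.Space :=
  inferInstanceAs (AddCommGroup E)

instance : Module ℂ P.Space :=
  inferInstanceAs (Module ℂ E)

instance : Norm P.Space :=
  ⟨P.nrm⟩

/-- The identity map of `E` as a map into the seminormed copy. -/
def toSpace : E ≃ₗ[ℂ] P.Space :=
  LinearEquiv.refl ℂ E

variable [StarOrderedRing A]

/-- The Cauchy–Schwarz inequality for the semi-inner product. -/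
lemma norm_form_le (x y : E) : ‖P.form x y‖ ≤ √‖P.form x x‖ * √‖P.form y y‖ := by
  have key : ∀ c : ℝ, ‖P.form x x‖ < c → ‖P.form x y‖ ^ 2 ≤ c * ‖P.form y y‖ := by
    intro c hc
    have hc0 : 0 < c := (norm_nonneg _).trans_lt hc
    have h1 : P.form y x * P.form x y ≤ c • P.form y y := by
      have h := P.form_self_nonneg (P.act (P.form x y) x - (c : ℂ) • y)
      simp only [form_sub_left, form_sub_right, form_smul_left, form_smul_right, form_act,
        form_act_left, P.star_form] at h
      have h2 : P.form y x * P.form x x * P.form x y ≤ c • (P.form y x * P.form x y) := by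
        have h3 : star (P.form x y) * P.form x x * P.form x y
            ≤ ‖P.form x x‖ • (star (P.form x y) * P.form x y) :=
          CStarAlgebra.star_left_conjugate_le_norm_smul
            (hb := (IsSelfAdjoint.of_nonneg (P.form_self_nonneg x)))
        rw [P.star_form] at h3
        refine h3.trans ?_
        have h4 : 0 ≤ P.form y x * P.form x y := by
          rw [← P.star_form x y]; exact star_mul_self_nonneg _
        exact smul_le_smul_of_nonneg_right hc.le h4
      have h5 : 0 ≤ c • (c • P.form y y - P.form y x * P.form x y) := by
        have e1 : ∀ z : A, (c : ℂ) • z = c • z := fun z => Complex.coe_smul c z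
        have e2 : star (c : ℂ) = (c : ℂ) := Complex.conj_ofReal c
        rw [e2] at h
        simp only [e1] at h
        refine h.trans ?_
        rw [← sub_nonneg] at h2 ⊢
        convert h2 using 1
        simp only [smul_sub, mul_assoc, sub_mul, smul_mul_assoc]
        abel
      have h6 := smul_nonneg (inv_nonneg.mpr hc0.le) h5
      rw [smul_smul, inv_mul_cancel₀ hc0.ne', one_smul, sub_nonneg] at h6
      exact h6
    have h4 : 0 ≤ P.form y x * P.form x y := by
      rw [← P.star_form x y]; exact star_mul_self_nonneg _
    have h7 := CStarAlgebra.norm_le_norm_of_nonneg_of_le h4 h1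
    rw [← P.star_form x y, CStarRing.norm_star_mul_self, norm_smul, Real.norm_of_nonneg hc0.le] at h7
    rwa [pow_two]
  have h8 : ‖P.form x y‖ ^ 2 ≤ ‖P.form x x‖ * ‖P.form y y‖ := by
    refine ge_of_tendsto (x := nhdsWithin ‖P.form x x‖ (Set.Ioi ‖P.form x x‖))
      (f := fun c : ℝ => c * ‖P.form y y‖) ?_ ?_
    · exact tendsto_nhdsWithin_of_tendsto_nhds
        ((continuous_id.mul continuous_const).tendsto _)
    · filter_upwards [self_mem_nhdsWithin] with c hc using key c hc
  rw [← Real.sqrt_mul (norm_nonneg _)]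
  exact Real.le_sqrt_of_sq_le h8

lemma nrm_add (x y : E) : P.nrm (x + y) ≤ P.nrm x + P.nrm y := by
  refine le_of_sq_le_sq ?_ (add_nonneg (P.nrm_nonneg x) (P.nrm_nonneg y))
  have h2 : P.form (x + y) (x + y)
      = P.form x x + P.form x y + (P.form y x + P.form y y) := by
    rw [form_add_left, form_add_right, form_add_right]
  have h3 : ‖P.form x y‖ ≤ P.nrm x * P.nrm y := P.norm_form_le x y
  have h4 : ‖P.form y x‖ ≤ P.nrm y * P.nrm x := P.norm_form_le y x
  calc P.nrm (x + y) ^ 2 = ‖P.form x x + P.form x y + (P.form y x + P.form y y)‖ := by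
        rw [nrm_sq, ← h2]
    _ ≤ ‖P.form x x‖ + ‖P.form x y‖ + (‖P.form y x‖ + ‖P.form y y‖) :=
        (norm_add_le _ _).trans (add_le_add (norm_add_le _ _) (norm_add_le _ _))
    _ ≤ (P.nrm x + P.nrm y) ^ 2 := by rw [← nrm_sq, ← nrm_sq]; nlinarith

lemma core : SeminormedSpace.Core ℂ P.Space where
  norm_nonneg x := P.nrm_nonneg x
  norm_smul c x := P.nrm_smul c x
  norm_triangle x y := P.nrm_add x y

instance : SeminormedAddCommGroup P.Space := SeminormedAddCommGroup.ofCore P.core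
instance : NormedSpace ℂ P.Space where
  norm_smul_le c x := (P.nrm_smul c x).le

/-- The right action of `a` on the seminormed space. -/
def actL (a : A) : P.Space →L[ℂ] P.Space :=
  LinearMap.mkContinuous (P.act a : P.Space →ₗ[ℂ] P.Space) ‖a‖ fun x => P.nrm_act a x

instance : Inner Aᵐᵒᵖ P.Space := ⟨fun x y => op (P.form x y)⟩

lemma continuous_inner : Continuous fun p : P.Space × P.Space => inner Aᵐᵒᵖ p.1 p.2 := by
  let F : P.Space →L⋆[ℂ] P.Space →L[ℂ] A :=
    LinearMap.mkContinuous₂ (LinearMap.mk₂'ₛₗ (starRingEnd ℂ) (RingHom.id ℂ)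
      (fun x y : P.Space => P.form x y) (fun x y z => P.form_add_left x y z)
      (fun c x y => P.form_smul_left c x y) (fun x y z => P.form_add_right x y z)
      (fun c x y => P.form_smul_right c x y)) 1 (fun x y => by
        rw [one_mul]; exact P.norm_form_le x y)
  have : Continuous fun p : P.Space × P.Space => F p.1 p.2 := by fun_prop
  exact continuous_op.comp this

/-- The completion of the seminormed space (which also divides out the vectors of length zero). -/
abbrev Compl : Type v := UniformSpace.Completion P.Space

open UniformSpace

lemma inner_coe (x y : P.Space) :
    inner Aᵐᵒᵖ (x : P.Compl) (y : P.Compl) = op (P.form x y) :=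
  (Completion.isDenseInducing_coe.prodMap Completion.isDenseInducing_coe).extend_eq
    P.continuous_inner (x, y)

lemma continuous_inner_compl :
    Continuous fun p : P.Compl × P.Compl => inner Aᵐᵒᵖ p.1 p.2 := by
  let inner' : P.Space →+ P.Space →+ Aᵐᵒᵖ :=
    { toFun := fun x =>
        { toFun := fun y => inner Aᵐᵒᵖ x y
          map_zero' := congrArg op (P.form_zero_right x)
          map_add' := fun y z => congrArg op (P.form_add_right x y z) }
      map_zero' := by
        ext y
        exact congrArg op (P.form_zero_left y)
      map_add' := fun x y => by ext z; exact congrArg op (P.form_add_left x y z) }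
  have : Continuous fun p : P.Space × P.Space => inner' p.1 p.2 := P.continuous_inner
  exact (Completion.isDenseInducing_toCompl P.Space).extend_Z_bilin
    (Completion.isDenseInducing_toCompl P.Space) this

lemma continuous_inner_compl' {Z : Type*} [TopologicalSpace Z] {f g : Z → P.Compl}
    (hf : Continuous f) (hg : Continuous g) : Continuous fun z => inner Aᵐᵒᵖ (f z) (g z) :=
  P.continuous_inner_compl.comp (hf.prodMk hg)

instance : SMul Aᵐᵒᵖ P.Compl := ⟨fun a x => Completion.map (P.actL (unop a)) x⟩

lemma op_smul_coe (a : A) (x : P.Space) : op a • (x : P.Compl) = ((P.actL a x : P.Space) : P.Compl) :=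
  Completion.map_coe (P.actL a).uniformContinuous x

lemma continuous_op_smul (a : Aᵐᵒᵖ) : Continuous fun x : P.Compl => a • x :=
  Completion.continuous_map

lemma norm_compl (x : P.Compl) : ‖x‖ = √‖inner Aᵐᵒᵖ x x‖ := by
  induction x using Completion.induction_on with
  | hp =>
    exact isClosed_eq continuous_norm (Real.continuous_sqrt.comp (continuous_norm.comp
        (P.continuous_inner_compl' continuous_id continuous_id)))
  | ih x =>
    rw [Completion.norm_coe, inner_coe]
    rfl

instance : CStarModule Aᵐᵒᵖ P.Compl where
  inner_add_right {x y z} := by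
    induction x, y, z using Completion.induction_on₃ with
    | hp =>
      exact isClosed_eq (P.continuous_inner_compl' (by fun_prop) (by fun_prop))
        ((P.continuous_inner_compl' (by fun_prop) (by fun_prop)).add
          (P.continuous_inner_compl' (by fun_prop) (by fun_prop)))
    | ih x y z =>
      rw [← Completion.coe_add, inner_coe, inner_coe, inner_coe]
      exact congrArg op (P.form_add_right x y z)
  inner_self_nonneg {x} := by
    induction x using Completion.induction_on with
    | hp =>
      exact isClosed_Ici.preimage (P.continuous_inner_compl' continuous_id continuous_id)
    | ih x => rw [inner_coe]; exact P.form_self_nonneg x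
  inner_self {x} := by
    rw [← norm_eq_zero (a := x), P.norm_compl x, Real.sqrt_eq_zero (norm_nonneg _), norm_eq_zero]
  inner_op_smul_right {a x y} := by
    induction x, y using Completion.induction_on₂ with
    | hp =>
      exact isClosed_eq (P.continuous_inner_compl' (by fun_prop)
          ((P.continuous_op_smul a).comp (by fun_prop)))
        (continuous_const.mul (P.continuous_inner_compl' (by fun_prop) (by fun_prop)))
    | ih x y =>
      rw [← op_unop a, op_smul_coe, inner_coe, inner_coe]
      exact congrArg op (P.form_act (unop a) x y)
  inner_smul_right_complex {c x y} := by
    induction x, y using Completion.induction_on₂ with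
    | hp =>
      exact isClosed_eq
        (P.continuous_inner_compl' continuous_fst (continuous_snd.const_smul c))
        ((P.continuous_inner_compl' continuous_fst continuous_snd).const_smul c)
    | ih x y =>
      rw [← Completion.coe_smul, inner_coe, inner_coe]
      exact congrArg op (P.form_smul_right c x y)
  star_inner x y := by
    induction x, y using Completion.induction_on₂ with
    | hp =>
      exact isClosed_eq (P.continuous_inner_compl' (by fun_prop) (by fun_prop)).star
        (P.continuous_inner_compl' (by fun_prop) (by fun_prop))
    | ih x y =>
      rw [inner_coe, inner_coe]
      exact congrArg op (P.star_form x y)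
  norm_eq_sqrt_norm_inner_self x := P.norm_compl x

/-- The Hilbert `A`-module obtained by completing a semi-inner product `A`-module. -/
def completion : HilbertModule.{u, v} A where
  carrier := P.Compl

end PreHilbert

section Tensor

variable {A : Type u} [NonUnitalCStarAlgebra A] [PartialOrder A]

/-- The sesquilinear form on the algebraic tensor product `X ⊙ M` with
`⟨x ⊗ m, y ⊗ n⟩ = ⟨m, ⟨x, y⟩ · n⟩ = ⟨⟨y, x⟩ · m, n⟩`. -/
def tensorForm (X : HilbertModule.{u, v} A) (M : Correspondence.{u, v} A) :
    (X ⊗[ℂ] M.carrier) →ₗ⋆[ℂ] (X ⊗[ℂ] M.carrier) →ₗ[ℂ] A :=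
  TensorProduct.lift (LinearMap.mk₂'ₛₗ (starRingEnd ℂ) (starRingEnd ℂ)
    (fun x m => TensorProduct.lift (LinearMap.mk₂ ℂ
      (fun y n => ip (X := M.toHilbertModule) m (M.left (ip x y) n))
      (fun y y' n => by simp only [ip_add_right, map_add, add_apply])
      (fun c y n => by simp only [ip_smul_right, map_smul, smul_apply])
      (fun y n n' => by simp only [map_add, ip_add_right])
      (fun c y n => by simp only [map_smul, ip_smul_right])))
    (fun x x' m => TensorProduct.ext' fun y n => by
      simp [ip_add_left, ip_add_right])
    (fun c x m => TensorProduct.ext' fun y n => by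
      simp [ip_smul_left, ip_smul_right])
    (fun x m m' => TensorProduct.ext' fun y n => by
      simp [ip_add_left])
    (fun c x m => TensorProduct.ext' fun y n => by
      simp [ip_smul_left]))

lemma tensorForm_tmul (X : HilbertModule.{u, v} A) (M : Correspondence.{u, v} A)
    (x y : X) (m n : M.carrier) :
    tensorForm X M (x ⊗ₜ m) (y ⊗ₜ n) = ip (X := M.toHilbertModule) m (M.left (ip x y) n) := rfl

/-- The right action of `a` on a Hilbert module as a complex-linear map. -/
def ractₗ (X : HilbertModule.{u, v} A) (a : A) : X →ₗ[ℂ] X where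
  toFun x := ract x a
  map_add' x y := ract_add x y a
  map_smul' c x := ract_smul c x a

variable [StarOrderedRing A]

/-- The algebraic tensor product `X ⊙ M` as a semi-inner product module. -/
def preTensor (X : HilbertModule.{u, v} A) (M : Correspondence.{u, v} A) :
    PreHilbert A (X ⊗[ℂ] M.carrier) where
  form s t := tensorForm X M s t
  act a := LinearMap.lTensor X (ractₗ M.toHilbertModule a)
  form_add_right s t t' := map_add _ _ _
  form_smul_right c s t := map_smul _ _ _
  star_form s t := by
    induction s using TensorProduct.induction_on with
    | zero => simp
    | add s s' hs hs' => simp only [map_add, LinearMap.add_apply, star_add, hs, hs']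
    | tmul x m =>
      induction t using TensorProduct.induction_on with
      | zero => simp
      | add t t' ht ht' => simp only [map_add, LinearMap.add_apply, star_add, ht, ht']
      | tmul y n => rw [tensorForm_tmul, tensorForm_tmul, star_ip, M.ip_left, star_ip]
  form_self_nonneg t := by
    obtain ⟨N, x, m, rfl⟩ : ∃ (N : ℕ) (x : Fin N → X) (m : Fin N → M.carrier),
        t = ∑ i, x i ⊗ₜ[ℂ] m i := by
      obtain ⟨S, rfl⟩ := TensorProduct.exists_finset t
      refine ⟨S.card, fun i => (S.equivFin.symm i).1.1, fun i => (S.equivFin.symm i).1.2, ?_⟩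
      rw [Equiv.sum_comp S.equivFin.symm (fun p : S => p.1.1 ⊗ₜ[ℂ] p.1.2),
        Finset.sum_coe_sort S (fun p => p.1 ⊗ₜ[ℂ] p.2)]
    obtain ⟨b, hb⟩ := exists_gram x
    have : tensorForm X M (∑ i, x i ⊗ₜ[ℂ] m i) (∑ i, x i ⊗ₜ[ℂ] m i)
        = ∑ k, ip (X := M.toHilbertModule) (∑ i, M.left (b k i) (m i))
            (∑ j, M.left (b k j) (m j)) := by
      simp only [map_sum, LinearMap.sum_apply, tensorForm_tmul, hb, ip_sum_left, ip_sum_right,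
        M.ip_left, map_mul, sum_apply, mul_apply_eq_comp]
      refine (Finset.sum_congr rfl fun _ _ => Finset.sum_comm).trans ?_
      rw [Finset.sum_comm]
    rw [this]
    exact Finset.sum_nonneg fun k _ => ip_self_nonneg _
  form_act a s t := by
    induction s using TensorProduct.induction_on with
    | zero => simp
    | add s s' hs hs' => simp only [map_add, LinearMap.add_apply, add_mul, hs, hs']
    | tmul x m =>
      induction t using TensorProduct.induction_on with
      | zero => simp
      | add t t' ht ht' => simp only [map_add, add_mul, ht, ht']
      | tmul y n =>
        have h : ∀ (c : A) (n : M.carrier),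
            ip (X := M.toHilbertModule) m (M.left c n)
              = ip (X := M.toHilbertModule) (M.left (star c) m) n := fun c n => by
          rw [M.ip_left, star_star]
        rw [LinearMap.lTensor_tmul, tensorForm_tmul, tensorForm_tmul, h, h]
        exact ip_ract_right _ _ _

/-- The internal tensor product `X ⊗_A M`: the completion of the algebraic tensor product. -/
def HilbertModule.tensor (X : HilbertModule.{u, v} A) (M : Correspondence.{u, v} A) :
    HilbertModule.{u, v} A :=
  (preTensor X M).completion

/-- The image of the algebraic tensor product in `X ⊗_A M`. -/
def algToTensor (X : HilbertModule.{u, v} A) (M : Correspondence.{u, v} A)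
    (t : X ⊗[ℂ] M.carrier) : X.tensor M :=
  (((preTensor X M).toSpace t : (preTensor X M).Space) : (preTensor X M).Compl)

/-- The elementary tensor `x ⊗ m` in `X ⊗_A M`. -/
def tmul {X : HilbertModule.{u, v} A} {M : Correspondence.{u, v} A} (x : X) (m : M.carrier) :
    X.tensor M :=
  algToTensor X M (x ⊗ₜ[ℂ] m)

lemma ip_algToTensor (X : HilbertModule.{u, v} A) (M : Correspondence.{u, v} A)
    (s t : X ⊗[ℂ] M.carrier) :
    ip (algToTensor X M s) (algToTensor X M t) = tensorForm X M s t :=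
  congrArg unop ((preTensor X M).inner_coe _ _)

lemma ip_tmul {X : HilbertModule.{u, v} A} {M : Correspondence.{u, v} A} (x y : X)
    (m n : M.carrier) :
    ip (tmul x m) (tmul y n) = ip (X := M.toHilbertModule) (M.left (ip y x) m) n := by
  rw [tmul, tmul, ip_algToTensor, tensorForm_tmul, M.ip_left, star_ip]

lemma tensor_induction {X : HilbertModule.{u, v} A} {M : Correspondence.{u, v} A}
    (p : X.tensor M → Prop) (hp : IsClosed {z | p z})
    (h : ∀ t, p (algToTensor X M t)) (z : X.tensor M) : p z :=
  UniformSpace.Completion.induction_on (α := (preTensor X M).Space) z hp h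

lemma algToTensor_add {X : HilbertModule.{u, v} A} {M : Correspondence.{u, v} A}
    (s t : X ⊗[ℂ] M.carrier) :
    algToTensor X M (s + t) = algToTensor X M s + algToTensor X M t :=
  UniformSpace.Completion.coe_add (α := (preTensor X M).Space) _ _

lemma algToTensor_smul {X : HilbertModule.{u, v} A} {M : Correspondence.{u, v} A}
    (c : ℂ) (t : X ⊗[ℂ] M.carrier) :
    algToTensor X M (c • t) = c • algToTensor X M t :=
  UniformSpace.Completion.coe_smul c ((preTensor X M).toSpace t)

lemma HilbertModule.continuous_ip {X : HilbertModule.{u, v} A} :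
    Continuous fun p : X × X => ip p.1 p.2 :=
  continuous_unop.comp (CStarModule.continuous_inner (A := Aᵐᵒᵖ) (E := X))

end Tensor

section Maps

variable {A : Type u} [NonUnitalCStarAlgebra A] [PartialOrder A]

/-- Inner-product preserving maps of Hilbert modules (they are automatically `A`-linear). -/
structure IPMap (X Y : HilbertModule.{u, v} A) extends X.carrier →ₗ[ℂ] Y.carrier where
  ip_map : ∀ x y : X, ip (toLinearMap x) (toLinearMap y) = ip x y

instance (X Y : HilbertModule.{u, v} A) : CoeFun (IPMap X Y) (fun _ => X → Y) :=
  ⟨fun S => S.toLinearMap⟩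

/-- Isomorphisms of Hilbert modules. -/
structure HilbertIso (X Y : HilbertModule.{u, v} A) extends X.carrier ≃ₗ[ℂ] Y.carrier where
  ip_map : ∀ x y : X, ip (toLinearEquiv x) (toLinearEquiv y) = ip x y

instance (X Y : HilbertModule.{u, v} A) : CoeFun (HilbertIso X Y) (fun _ => X → Y) :=
  ⟨fun S => S.toLinearEquiv⟩

namespace IPMap

variable {X Y Z : HilbertModule.{u, v} A}

/-- Existence of an adjoint map. -/
def IsAdjointable (S : IPMap X Y) : Prop :=
  ∃ S' : Y → X, ∀ (x : X) (y : Y), ip (S x) y = ip x (S' y)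

/-- The range, as a complex subspace. -/
def range (S : IPMap X Y) : Submodule ℂ Y := LinearMap.range S.toLinearMap

lemma map_ract (S : IPMap X Y) (x : X) (a : A) : S (ract x a) = ract (S x) a := by
  rw [← sub_eq_zero, ← ip_self_eq_zero]
  simp only [ip_sub_left, ip_sub_right, ip_ract_left, ip_ract_right, S.ip_map]
  simp [mul_assoc]

lemma norm_map (S : IPMap X Y) (x : X) : ‖S x‖ = ‖x‖ := by
  rw [norm_eq, norm_eq, S.ip_map]

lemma isometry (S : IPMap X Y) : Isometry S :=
  AddMonoidHomClass.isometry_of_norm S.toLinearMap S.norm_map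

lemma tensorForm_rTensor (S : IPMap X Y) (M : Correspondence.{u, v} A) (s t : X ⊗[ℂ] M.carrier) :
    tensorForm Y M (S.toLinearMap.rTensor M.carrier s) (S.toLinearMap.rTensor M.carrier t)
      = tensorForm X M s t := by
  induction s using TensorProduct.induction_on with
  | zero => simp
  | add s s' hs hs' => simp only [map_add, LinearMap.add_apply, hs, hs']
  | tmul x m =>
    induction t using TensorProduct.induction_on with
    | zero => simp
    | add t t' ht ht' => simp only [map_add, ht, ht']
    | tmul y n =>
      rw [LinearMap.rTensor_tmul, LinearMap.rTensor_tmul, tensorForm_tmul, tensorForm_tmul,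
        S.ip_map]

variable [StarOrderedRing A]

/-- `S ⊗ id` on the seminormed algebraic tensor products. -/
def preTensorId (S : IPMap X Y) (M : Correspondence.{u, v} A) :
    (preTensor X M).Space →ₗᵢ[ℂ] (preTensor Y M).Space where
  toLinearMap := (S.toLinearMap.rTensor M.carrier : X ⊗[ℂ] M.carrier →ₗ[ℂ] Y ⊗[ℂ] M.carrier)
  norm_map' t := congrArg (fun a : A => √‖a‖) (S.tensorForm_rTensor M t t)

/-- The continuous extension of `S ⊗ id` to the completions. -/
def tensorIdFun (S : IPMap X Y) (M : Correspondence.{u, v} A) : X.tensor M → Y.tensor M :=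
  UniformSpace.Completion.map (S.preTensorId M)

lemma tensorIdFun_alg (S : IPMap X Y) (M : Correspondence.{u, v} A) (t : X ⊗[ℂ] M.carrier) :
    S.tensorIdFun M (algToTensor X M t)
      = algToTensor Y M (S.toLinearMap.rTensor M.carrier t) :=
  UniformSpace.Completion.map_coe (S.preTensorId M).isometry.uniformContinuous _

lemma continuous_tensorIdFun (S : IPMap X Y) (M : Correspondence.{u, v} A) :
    Continuous (S.tensorIdFun M) :=
  UniformSpace.Completion.continuous_map

/-- The inner-product preserving map `S ⊗ id : X ⊗_A M → Y ⊗_A M`. -/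
def tensorId (S : IPMap X Y) (M : Correspondence.{u, v} A) : IPMap (X.tensor M) (Y.tensor M) where
  toFun := S.tensorIdFun M
  map_add' z w := by
    have hc := S.continuous_tensorIdFun M
    refine tensor_induction (fun z => S.tensorIdFun M (z + w)
      = S.tensorIdFun M z + S.tensorIdFun M w) (isClosed_eq (by fun_prop) (by fun_prop))
      (fun s => ?_) z
    refine tensor_induction (fun w => S.tensorIdFun M (algToTensor X M s + w)
      = S.tensorIdFun M (algToTensor X M s) + S.tensorIdFun M w)
      (isClosed_eq (by fun_prop) (by fun_prop)) (fun t => ?_) w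
    simp only [← algToTensor_add, tensorIdFun_alg, map_add]
  map_smul' c z := by
    have hc := S.continuous_tensorIdFun M
    refine tensor_induction (fun z => S.tensorIdFun M (c • z) = c • S.tensorIdFun M z)
      (isClosed_eq (hc.comp (continuous_const_smul c)) (hc.const_smul c)) (fun s => ?_) z
    rw [← algToTensor_smul, tensorIdFun_alg, tensorIdFun_alg, map_smul, algToTensor_smul]
  ip_map z w := by
    have hc := S.continuous_tensorIdFun M
    refine tensor_induction (fun z => ip (S.tensorIdFun M z) (S.tensorIdFun M w) = ip z w)
      (isClosed_eq (continuous_ip.comp (hc.prodMk continuous_const))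
        (continuous_ip.comp (continuous_id.prodMk continuous_const))) (fun s => ?_) z
    refine tensor_induction (fun w => ip (S.tensorIdFun M (algToTensor X M s))
      (S.tensorIdFun M w) = ip (algToTensor X M s) w)
      (isClosed_eq (continuous_ip.comp (continuous_const.prodMk hc))
        (continuous_ip.comp (continuous_const.prodMk continuous_id))) (fun t => ?_) w
    rw [tensorIdFun_alg, tensorIdFun_alg, ip_algToTensor, ip_algToTensor, tensorForm_rTensor]

lemma tensorId_tmul (S : IPMap X Y) (M : Correspondence.{u, v} A) (x : X) (m : M.carrier) :
    S.tensorId M (tmul x m) = tmul (S x) m :=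
  S.tensorIdFun_alg M (x ⊗ₜ[ℂ] m)

lemma tensorId_leftInverse (S : IPMap X Y) (S' : IPMap Y X) (h : ∀ x, S' (S x) = x)
    (M : Correspondence.{u, v} A) (z : X.tensor M) : S'.tensorId M (S.tensorId M z) = z := by
  have hS := S.continuous_tensorIdFun M
  have hS' := S'.continuous_tensorIdFun M
  refine tensor_induction (fun z => S'.tensorIdFun M (S.tensorIdFun M z) = z)
    (isClosed_eq (hS'.comp hS) continuous_id) (fun t => ?_) z
  rw [tensorIdFun_alg, tensorIdFun_alg, ← LinearMap.rTensor_comp_apply]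
  have : S'.toLinearMap ∘ₗ S.toLinearMap = LinearMap.id := LinearMap.ext h
  rw [this, LinearMap.rTensor_id, LinearMap.id_apply]

end IPMap

namespace HilbertIso

variable {X Y Z : HilbertModule.{u, v} A}

/-- An isomorphism as an inner-product preserving map. -/
def toIPMap (U : HilbertIso X Y) : IPMap X Y where
  toLinearMap := U.toLinearEquiv
  ip_map := U.ip_map

/-- The inverse isomorphism. -/
def symm (U : HilbertIso X Y) : HilbertIso Y X where
  toLinearEquiv := U.toLinearEquiv.symm
  ip_map x y := by
    rw [← U.ip_map]
    simp

/-- The identity. -/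
def refl (X : HilbertModule.{u, v} A) : HilbertIso X X where
  toLinearEquiv := LinearEquiv.refl ℂ X
  ip_map _ _ := rfl

/-- The composition `V ∘ U`. -/
def trans (U : HilbertIso X Y) (V : HilbertIso Y Z) : HilbertIso X Z where
  toLinearEquiv := U.toLinearEquiv.trans V.toLinearEquiv
  ip_map x y := (V.ip_map _ _).trans (U.ip_map x y)

variable [StarOrderedRing A]

/-- The isomorphism `U ⊗ id : X ⊗_A M → Y ⊗_A M`. -/
def tensorId (U : HilbertIso X Y) (M : Correspondence.{u, v} A) :
    HilbertIso (X.tensor M) (Y.tensor M) where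
  toLinearEquiv := LinearEquiv.ofLinearMap (U.toIPMap.tensorId M).toLinearMap
    (U.symm.toIPMap.tensorId M).toLinearMap
    (LinearMap.ext fun z => U.symm.toIPMap.tensorId_leftInverse U.toIPMap
      (fun y => U.toLinearEquiv.apply_symm_apply y) M z)
    (LinearMap.ext fun z => U.toIPMap.tensorId_leftInverse U.symm.toIPMap
      (fun x => U.toLinearEquiv.symm_apply_apply x) M z)
  ip_map := (U.toIPMap.tensorId M).ip_map

end HilbertIso

end Maps

section Powers

variable {A : Type u} [NonUnitalCStarAlgebra A] [PartialOrder A] [StarOrderedRing A]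

/-- `X ⊗_A M^{⊗ k}`, bracketed as `((X ⊗_A M) ⊗_A M) ⊗_A ⋯ ⊗_A M`; it is `X` for `k = 0`. -/
def HilbertModule.tpow (X : HilbertModule.{u, v} A) (M : Correspondence.{u, v} A) :
    ℕ → HilbertModule.{u, v} A
  | 0 => X
  | k + 1 => (X.tpow M k).tensor M

/-- `S ⊗ id_k : X ⊗_A M^{⊗ k} → Y ⊗_A M^{⊗ k}`. -/
def IPMap.tpow {X Y : HilbertModule.{u, v} A} (S : IPMap X Y) (M : Correspondence.{u, v} A) :
    (k : ℕ) → IPMap (X.tpow M k) (Y.tpow M k)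
  | 0 => S
  | k + 1 => (S.tpow M k).tensorId M

/-- For `T : X → X ⊗_A M`, the map `T ⊗ id_k : X ⊗_A M^{⊗ k} → X ⊗_A M^{⊗ (k + 1)}`. -/
def IPMap.amp {M : Correspondence.{u, v} A} {X : HilbertModule.{u, v} A}
    (T : IPMap X (X.tensor M)) : (k : ℕ) → IPMap (X.tpow M k) (X.tpow M (k + 1))
  | 0 => T
  | k + 1 => (T.amp k).tensorId M

/-- For an isomorphism `U : X → X ⊗_A M`, the isomorphism
`U ⊗ id_k : X ⊗_A M^{⊗ k} → X ⊗_A M^{⊗ (k + 1)}`. -/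
def HilbertIso.amp {M : Correspondence.{u, v} A} {X : HilbertModule.{u, v} A}
    (U : HilbertIso X (X.tensor M)) : (k : ℕ) → HilbertIso (X.tpow M k) (X.tpow M (k + 1))
  | 0 => U
  | k + 1 => (U.amp k).tensorId M

/-- The isomorphisms `U^k : X → X ⊗_A M^{⊗ k}`, with `U^0 = id` and
`U^{k+1} = (U ⊗ id_k) ∘ U^k`. -/
def HilbertIso.pow {M : Correspondence.{u, v} A} {X : HilbertModule.{u, v} A}
    (U : HilbertIso X (X.tensor M)) : (k : ℕ) → HilbertIso X (X.tpow M k)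
  | 0 => HilbertIso.refl X
  | k + 1 => (U.pow k).trans (U.amp k)

/-- For a closed submodule `V` of `X`, the submodule `V ⊗_A M^{⊗ k}` of `X ⊗_A M^{⊗ k}`: in each
step the closed linear span of the elementary tensors. -/
def HilbertModule.subTpow (X : HilbertModule.{u, v} A) (V : Submodule ℂ X)
    (M : Correspondence.{u, v} A) : (k : ℕ) → Submodule ℂ (X.tpow M k)
  | 0 => V
  | k + 1 => (Submodule.span ℂ
      {z : (X.tpow M k).tensor M | ∃ t ∈ X.subTpow V M k, ∃ m : M.carrier, z = tmul t m}
        ).topologicalClosure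

end Powers

section Limits

variable {A : Type u} [NonUnitalCStarAlgebra A] [PartialOrder A]

/-- Closed `A`-submodules of a Hilbert module. -/
structure IsClosedSubmodule {X : HilbertModule.{u, v} A} (V : Submodule ℂ X) : Prop where
  isClosed : IsClosed (V : Set X)
  ract_mem : ∀ x ∈ V, ∀ a : A, ract x a ∈ V

/-- The closed submodule `V` is contained and (orthogonally) complemented in the Hilbert module
`W`, where `W` is a closed submodule of `X`. -/
structure IsComplementedIn {X : HilbertModule.{u, v} A} (V W : Submodule ℂ X) : Prop where
  left : IsClosedSubmodule V
  right : IsClosedSubmodule W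
  le : V ≤ W
  exists_add : ∀ w ∈ W, ∃ v ∈ V, ∃ n ∈ W, (∀ v' ∈ V, ip v' n = 0) ∧ w = v + n

/-- `(L, ι)` is the direct limit of the system of Hilbert modules `X₀ → X₁ → X₂ → ⋯`: it has the
universal property for uniformly bounded compatible families of bounded module homomorphisms. -/
structure IsDirectLimit (X : ℕ → HilbertModule.{u, v} A) (T : ∀ k, IPMap (X k) (X (k + 1)))
    (L : HilbertModule.{u, v} A) (ι : ∀ k, IPMap (X k) L) : Prop where
  compat : ∀ (k : ℕ) (x : X k), ι (k + 1) (T k x) = ι k x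
  universal : ∀ (Z : HilbertModule.{u, v} A) (S : ∀ k, X k →L[ℂ] Z) (C : ℝ),
    (∀ (k : ℕ) (x : X k) (a : A), S k (ract x a) = ract (S k x) a) →
    (∀ (k : ℕ) (x : X k), S (k + 1) (T k x) = S k x) →
    (∀ k, ‖S k‖ ≤ C) →
    ∃! S' : L →L[ℂ] Z,
      (∀ (x : L) (a : A), S' (ract x a) = ract (S' x) a) ∧ ‖S'‖ ≤ C ∧
        ∀ (k : ℕ) (x : X k), S' (ι k x) = S k x

variable [StarOrderedRing A]

/-- `V₀, V₁, …` is a projective multi-resolution analysis for the closed submodule `W` of `X`,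
with respect to the isomorphism `U : X → X ⊗_A M`. -/
structure IsProjectiveMRA {M : Correspondence.{u, v} A} {X : HilbertModule.{u, v} A}
    (U : HilbertIso X (X.tensor M)) (W : Submodule ℂ X) (V : ℕ → Submodule ℂ X) : Prop where
  complemented_zero : IsComplementedIn (V 0) W
  eq_pow_symm : ∀ k,
    V k = (X.subTpow (V 0) M k).map ((U.pow k).symm.toLinearEquiv : X.tpow M k →ₗ[ℂ] X)
  complemented_succ : ∀ k, IsComplementedIn (V k) (V (k + 1))
  le : ∀ k, V k ≤ W
  dense : (W : Set X) ⊆ closure (⋃ k, (V k : Set X))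

end Limits

end

/-!
Among compatible families of inner-product preserving maps `ι k`, direct limits are recognised by
the density of the union of the ranges, and this condition survives both tensoring with `M` and a
shift of the index. Tensored with `M`, the system `(Y ⊗ M^{⊗ k}, T_k)` becomes its own shift, so
`Y_∞` and `Y_∞ ⊗ M` are limits of one and the same system, and `R` is the comparison isomorphism.
The maps `D^{-k} ∘ (Q₀ ⊗ id_k)` are compatible, and `Q` is the map they induce on `Y_∞`.

The range of `T` is complemented because `T` has an adjoint, and `n ⟂ ran S` implies
`n ⊗ m ⟂ ran (S ⊗ id)`, so the range of each `T_k` is complemented as well. As `V ⊕ V^⊥` is always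
closed, a submodule that is complemented in every `Y_k` is complemented in the closure of their
union.
-/

noncomputable section

open MulOpposite HilbertModule

section Maps

variable {A : Type u} [NonUnitalCStarAlgebra A] [PartialOrder A]
  {X Y Z W : HilbertModule.{u, v} A}

namespace IPMap

lemma ext {S S' : IPMap X Y} (h : ∀ x, S x = S' x) : S = S' := by
  cases S
  cases S'
  congr
  exact LinearMap.ext h

lemma congr_fun {S S' : IPMap X Y} (h : S = S') (x : X) : S x = S' x := by
  rw [h]

lemma continuous (S : IPMap X Y) : Continuous S :=
  S.isometry.continuous

/-- `S` as a bounded operator, forgetting the module structure. -/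
def toCLM (S : IPMap X Y) : X →L[ℂ] Y :=
  ⟨S.toLinearMap, S.continuous⟩

lemma norm_toCLM_le (S : IPMap X Y) : ‖S.toCLM‖ ≤ 1 :=
  S.toCLM.opNorm_le_bound zero_le_one fun x => (S.norm_map x).trans_le (one_mul _).ge

/-- The identity of `X` as an inner-product preserving map. -/
def id (X : HilbertModule.{u, v} A) : IPMap X X where
  toLinearMap := LinearMap.id
  ip_map _ _ := rfl

/-- The composition `S ∘ S'` of inner-product preserving maps. -/
def comp (S : IPMap Y Z) (S' : IPMap X Y) : IPMap X Z where
  toLinearMap := S.toLinearMap ∘ₗ S'.toLinearMap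
  ip_map x y := (S.ip_map _ _).trans (S'.ip_map x y)

lemma comp_apply (S : IPMap Y Z) (S' : IPMap X Y) (x : X) : S.comp S' x = S (S' x) := rfl

lemma comp_assoc (S : IPMap Z W) (S' : IPMap Y Z) (S'' : IPMap X Y) :
    (S.comp S').comp S'' = S.comp (S'.comp S'') := rfl

lemma id_comp (S : IPMap X Y) : (id Y).comp S = S := rfl

lemma comp_id (S : IPMap X Y) : S.comp (id X) = S := rfl

lemma range_comp (S : IPMap Y Z) (S' : IPMap X Y) :
    (S.comp S').range = S'.range.map S.toLinearMap :=
  LinearMap.range_comp _ _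

lemma ext_of_dense {S S' : IPMap X Y} {V : Submodule ℂ X} (hV : Dense (V : Set X))
    (h : V ≤ LinearMap.eqLocus S.toLinearMap S'.toLinearMap) : S = S' :=
  ext (congrFun (S.continuous.ext_on hV S'.continuous h))

end IPMap

namespace HilbertIso

lemma ext {U U' : HilbertIso X Y} (h : U.toIPMap = U'.toIPMap) : U = U' := by
  cases U
  cases U'
  congr
  exact LinearEquiv.toLinearMap_injective (congrArg IPMap.toLinearMap h)

lemma symm_comp (U : HilbertIso X Y) : U.symm.toIPMap.comp U.toIPMap = IPMap.id X :=
  IPMap.ext U.toLinearEquiv.symm_apply_apply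

lemma comp_symm (U : HilbertIso X Y) : U.toIPMap.comp U.symm.toIPMap = IPMap.id Y :=
  IPMap.ext U.toLinearEquiv.apply_symm_apply

lemma symm_comp_eq_iff {U : HilbertIso Y Z} {S : IPMap X Z} {S' : IPMap X Y} :
    U.symm.toIPMap.comp S = S' ↔ U.toIPMap.comp S' = S := by
  constructor
  · rintro rfl
    rw [← IPMap.comp_assoc, comp_symm, IPMap.id_comp]
  · rintro rfl
    rw [← IPMap.comp_assoc, symm_comp, IPMap.id_comp]

/-- Mutually inverse inner-product preserving maps as an isomorphism. -/
def ofIPMap (S : IPMap X Y) (S' : IPMap Y X) (h : S.comp S' = IPMap.id Y)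
    (h' : S'.comp S = IPMap.id X) : HilbertIso X Y where
  toLinearEquiv := LinearEquiv.ofLinearMap S.toLinearMap S'.toLinearMap
    (congrArg IPMap.toLinearMap h) (congrArg IPMap.toLinearMap h')
  ip_map := S.ip_map

end HilbertIso

end Maps

section Complements

variable {A : Type u} [NonUnitalCStarAlgebra A] [PartialOrder A] {X Y : HilbertModule.{u, v} A}

namespace HilbertModule

lemma norm_ract_le (x : X) (a : A) : ‖ract x a‖ ≤ ‖x‖ * ‖a‖ := by
  have h : ‖ip (ract x a) (ract x a)‖ ≤ ‖ip x x‖ * ‖a‖ ^ 2 := by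
    rw [ip_ract_right, ip_ract_left]
    refine (norm_mul_le _ _).trans ((mul_le_mul_of_nonneg_right (norm_mul_le _ _)
      (norm_nonneg a)).trans_eq ?_)
    rw [norm_star]
    ring
  rw [norm_eq, norm_eq, ← Real.sqrt_sq (norm_nonneg a), ← Real.sqrt_mul (norm_nonneg _)]
  exact Real.sqrt_le_sqrt h

lemma continuous_ract (a : A) : Continuous fun x : X => ract x a :=
  ((ractₗ X a).mkContinuous ‖a‖ fun x =>
    (norm_ract_le x a).trans_eq (mul_comm _ _)).continuous

end HilbertModule

lemma isClosedSubmodule_top : IsClosedSubmodule (⊤ : Submodule ℂ X) :=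
  ⟨isClosed_univ, fun _ _ _ => Submodule.mem_top⟩

lemma IsClosedSubmodule.map {V : Submodule ℂ X} (h : IsClosedSubmodule V) (S : IPMap X Y) :
    IsClosedSubmodule (V.map S.toLinearMap) where
  isClosed := S.isometry.isClosedEmbedding.isClosedMap _ h.isClosed
  ract_mem := by
    rintro _ ⟨x, hx, rfl⟩ a
    exact ⟨ract x a, h.ract_mem x hx a, S.map_ract x a⟩

lemma IPMap.range_eq_map (S : IPMap X Y) : S.range = (⊤ : Submodule ℂ X).map S.toLinearMap :=
  LinearMap.range_eq_map _

lemma IPMap.isClosedSubmodule_range (S : IPMap X Y) : IsClosedSubmodule S.range :=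
  S.range_eq_map ▸ isClosedSubmodule_top.map S

namespace HilbertModule

/-- The orthogonal complement of the subspace `V` for the `A`-valued inner product. -/
def perp (V : Submodule ℂ X) : Submodule ℂ X where
  carrier := {n | ∀ v ∈ V, ip v n = 0}
  add_mem' hn hn' v hv := by rw [ip_add_right, hn v hv, hn' v hv, add_zero]
  zero_mem' v _ := by simp [ip]
  smul_mem' c n hn v hv := by rw [ip_smul_right, hn v hv, smul_zero]

lemma mem_perp {V : Submodule ℂ X} {n : X} : n ∈ perp V ↔ ∀ v ∈ V, ip v n = 0 := Iff.rfl

lemma perp_anti {V W : Submodule ℂ X} (h : V ≤ W) : perp W ≤ perp V :=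
  fun _ hn v hv => hn v (h hv)

lemma le_perp_comm {V W : Submodule ℂ X} : V ≤ perp W ↔ W ≤ perp V := by
  suffices ∀ {V W : Submodule ℂ X}, V ≤ perp W → W ≤ perp V from ⟨this, this⟩
  intro V W h w hw v hv
  rw [← star_ip, h hv w hw, star_zero]

variable [StarOrderedRing A]

lemma isClosed_perp (V : Submodule ℂ X) : IsClosed (perp V : Set X) := by
  have : (perp V : Set X) = ⋂ v ∈ V, {n | ip v n = 0} := by ext; simp [mem_perp]
  rw [this]
  exact isClosed_biInter fun v _ =>
    isClosed_eq (continuous_ip.comp (.prodMk_right v)) continuous_const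

lemma norm_le_norm_add_of_ip_eq_zero {v n : X} (h : ip v n = 0) : ‖v‖ ≤ ‖v + n‖ := by
  have h' : ip n v = 0 := by rw [← star_ip, h, star_zero]
  have hadd : ip (v + n) (v + n) = ip v v + ip n n := by
    rw [ip_add_left, ip_add_right, ip_add_right, h, h', add_zero, zero_add]
  rw [norm_eq, norm_eq, hadd]
  exact Real.sqrt_le_sqrt <| CStarAlgebra.norm_le_norm_of_nonneg_of_le (ip_self_nonneg v)
    (le_add_of_nonneg_right (ip_self_nonneg n))

lemma isClosed_sup_perp {V : Submodule ℂ X} (hV : IsClosed (V : Set X)) :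
    IsClosed ((V ⊔ perp V : Submodule ℂ X) : Set X) := by
  have := hV.completeSpace_coe
  have := (isClosed_perp V).completeSpace_coe
  let add : V × perp V →ₗ[ℂ] X := V.subtype.coprod (perp V).subtype
  have hadd : AntilipschitzWith 1 add := AddMonoidHomClass.antilipschitz_of_bound add <| by
    rintro ⟨⟨v, hv⟩, ⟨n, hn⟩⟩
    have hvn : ip v n = 0 := hn v hv
    have hnv : ip n v = 0 := by rw [← star_ip, hvn, star_zero]
    rw [NNReal.coe_one, one_mul]
    refine max_le (norm_le_norm_add_of_ip_eq_zero hvn) ?_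
    exact (norm_le_norm_add_of_ip_eq_zero hnv).trans_eq (congrArg norm (add_comm n v))
  rw [Submodule.sup_eq_range]
  exact hadd.isClosed_range (V.subtypeL.coprod (perp V).subtypeL).uniformContinuous

end HilbertModule

lemma isComplementedIn_iff {V W : Submodule ℂ X} :
    IsComplementedIn V W ↔
      IsClosedSubmodule V ∧ IsClosedSubmodule W ∧ V ≤ W ∧ W ≤ V ⊔ perp V := by
  refine ⟨fun h => ⟨h.left, h.right, h.le, fun w hw => ?_⟩, fun ⟨hV, hW, hle, h⟩ =>
    ⟨hV, hW, hle, fun w hw => ?_⟩⟩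
  · obtain ⟨v, hv, n, -, hn, rfl⟩ := h.exists_add w hw
    exact Submodule.add_mem_sup hv hn
  · obtain ⟨v, hv, n, hn, rfl⟩ := Submodule.mem_sup.mp (h hw)
    exact ⟨v, hv, n, (W.add_mem_iff_right (hle hv)).mp hw, hn, rfl⟩

lemma IsComplementedIn.le_sup_perp {V W : Submodule ℂ X} (h : IsComplementedIn V W) :
    W ≤ V ⊔ perp V :=
  (isComplementedIn_iff.mp h).2.2.2

lemma IsClosedSubmodule.isComplementedIn_self {V : Submodule ℂ X} (h : IsClosedSubmodule V) :
    IsComplementedIn V V :=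
  isComplementedIn_iff.mpr ⟨h, h, le_rfl, le_sup_left⟩

lemma IsComplementedIn.trans {V V' W : Submodule ℂ X} (h : IsComplementedIn V V')
    (h' : IsComplementedIn V' W) : IsComplementedIn V W :=
  isComplementedIn_iff.mpr ⟨h.left, h'.right, h.le.trans h'.le, h'.le_sup_perp.trans <|
    sup_le h.le_sup_perp <| (perp_anti h.le).trans le_sup_right⟩

lemma IsComplementedIn.map {V W : Submodule ℂ X} (h : IsComplementedIn V W) (S : IPMap X Y) :
    IsComplementedIn (V.map S.toLinearMap) (W.map S.toLinearMap) := by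
  refine isComplementedIn_iff.mpr ⟨h.left.map S, h.right.map S, Submodule.map_mono h.le, ?_⟩
  refine (Submodule.map_mono h.le_sup_perp).trans ?_
  rw [Submodule.map_sup]
  refine sup_le_sup_left ?_ _
  rintro _ ⟨n, hn, rfl⟩ _ ⟨v, hv, rfl⟩
  exact (S.ip_map v n).trans (hn v hv)

lemma IPMap.IsAdjointable.isComplementedIn_range {S : IPMap X Y} (h : S.IsAdjointable) :
    IsComplementedIn S.range ⊤ := by
  obtain ⟨S', hS'⟩ := h
  refine isComplementedIn_iff.mpr ⟨S.isClosedSubmodule_range, isClosedSubmodule_top, le_top,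
    fun y _ => Submodule.mem_sup.mpr ⟨S (S' y), ⟨S' y, rfl⟩, y - S (S' y), ?_, by abel⟩⟩
  rintro _ ⟨x, rfl⟩
  rw [ip_sub_right, S.ip_map, hS', sub_self]

end Complements

section Tensor

variable {A : Type u} [NonUnitalCStarAlgebra A] [PartialOrder A] [StarOrderedRing A]
  {X Y Z : HilbertModule.{u, v} A} {M : Correspondence.{u, v} A}

/-- The positive linear map `a ↦ ⟨m, a · m⟩` on `A` given by a vector `m` of a correspondence. -/
def Correspondence.vectorMap (M : Correspondence.{u, v} A) (m : M.carrier) : A →ₚ[ℂ] A :=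
  .mk₀
    { toFun a := ip (X := M.toHilbertModule) m (M.left a m)
      map_add' a b := by rw [map_add]; exact ip_add_right (X := M.toHilbertModule) _ _ _
      map_smul' c a := by rw [map_smul]; exact ip_smul_right (X := M.toHilbertModule) _ _ _ }
    fun a ha => by
      obtain ⟨c, rfl⟩ := CStarAlgebra.nonneg_iff_eq_star_mul_self.mp ha
      have h : M.left (star c * c) m = M.left (star c) (M.left c m) := by rw [map_mul]; rfl
      change 0 ≤ ip (X := M.toHilbertModule) m (M.left (star c * c) m)
      rw [h, ← M.ip_left]
      exact ip_self_nonneg _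

lemma norm_tmul (x : X) (m : M.carrier) : ‖tmul (M := M) x m‖ = √‖M.vectorMap m (ip x x)‖ := by
  rw [norm_eq, ip_tmul, M.ip_left, star_ip]
  rfl

lemma tmul_add_left (x y : X) (m : M.carrier) :
    tmul (M := M) (x + y) m = tmul x m + tmul y m := by
  rw [tmul, TensorProduct.add_tmul, algToTensor_add]
  rfl

-- A positive linear map between C⋆-algebras is automatically continuous.
lemma continuous_tmul_left (m : M.carrier) : Continuous fun x : X => tmul (M := M) x m := by
  let f : X →+ X.tensor M := .mk' (tmul · m) fun x y => tmul_add_left x y m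
  refine continuous_of_continuousAt_zero f <| tendsto_iff_norm_sub_tendsto_zero.mpr ?_
  have hcont : Continuous fun x : X => √‖M.vectorMap m (ip x x)‖ :=
    ((map_continuous (M.vectorMap m)).comp
      (continuous_ip.comp (continuous_id.prodMk continuous_id))).norm.sqrt
  have hf : ∀ x, ‖f x - f 0‖ = √‖M.vectorMap m (ip x x)‖ := fun x => by
    rw [map_zero, sub_zero, ← norm_tmul]
    rfl
  simp only [hf]
  simpa [ip] using hcont.tendsto 0

lemma eq_top_of_tmul_mem {N : Submodule ℂ (X.tensor M)} (hN : IsClosed (N : Set (X.tensor M)))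
    (h : ∀ x m, tmul x m ∈ N) : N = ⊤ := by
  refine eq_top_iff.mpr fun z _ => tensor_induction (· ∈ N) hN (fun t => ?_) z
  induction t using TensorProduct.induction_on with
  | zero => simpa [tmul] using h 0 0
  | tmul x m => exact h x m
  | add s t hs ht => rw [algToTensor_add]; exact N.add_mem hs ht

namespace IPMap

lemma tensor_ext {S S' : IPMap (X.tensor M) Z} (h : ∀ x m, S (tmul x m) = S' (tmul x m)) :
    S = S' := by
  have hclosed : IsClosed (LinearMap.eqLocus S.toLinearMap S'.toLinearMap : Set (X.tensor M)) :=
    isClosed_eq S.continuous S'.continuous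
  exact ext_of_dense dense_univ (eq_top_of_tmul_mem hclosed h).ge

lemma tensorId_comp (S : IPMap Y Z) (S' : IPMap X Y) (M : Correspondence.{u, v} A) :
    (S.comp S').tensorId M = (S.tensorId M).comp (S'.tensorId M) :=
  tensor_ext fun x m => by simp only [comp_apply, tensorId_tmul]

lemma tensorId_id (X : HilbertModule.{u, v} A) (M : Correspondence.{u, v} A) :
    (id X).tensorId M = id (X.tensor M) :=
  tensor_ext fun x m => (id X).tensorId_tmul M x m

lemma range_tensorId (S : IPMap X Y) (M : Correspondence.{u, v} A) : (S.tensorId M).range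
    = (Submodule.span ℂ {z : Y.tensor M | ∃ t ∈ S.range, ∃ m : M.carrier, z = tmul t m}
      ).topologicalClosure := by
  apply le_antisymm
  · refine LinearMap.range_le_iff_comap.mpr <| eq_top_of_tmul_mem
      ((Submodule.isClosed_topologicalClosure _).preimage (S.tensorId M).continuous) fun x m => ?_
    exact Submodule.le_topologicalClosure _ <|
      Submodule.subset_span ⟨S x, ⟨x, rfl⟩, m, S.tensorId_tmul M x m⟩
  · refine Submodule.topologicalClosure_minimal _ (Submodule.span_le.mpr ?_)
      (S.tensorId M).isClosedSubmodule_range.isClosed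
    rintro _ ⟨_, ⟨x, rfl⟩, m, rfl⟩
    exact ⟨tmul x m, S.tensorId_tmul M x m⟩

lemma tmul_mem_perp_range_tensorId (S : IPMap X Y) {n : Y} (hn : n ∈ perp S.range)
    (m : M.carrier) : tmul n m ∈ perp (S.tensorId M).range := by
  suffices (S.tensorId M).range ≤ perp (ℂ ∙ tmul n m) from
    le_perp_comm.mp this (Submodule.mem_span_singleton_self _)
  rw [range_tensorId]
  refine Submodule.topologicalClosure_minimal _ (Submodule.span_le.mpr ?_) (isClosed_perp _)
  rintro _ ⟨_, ⟨x, rfl⟩, m', rfl⟩ w hw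
  obtain ⟨c, rfl⟩ := Submodule.mem_span_singleton.mp hw
  rw [ip_smul_left, ip_tmul, hn (S x) ⟨x, rfl⟩, map_zero]
  simp [ip]

end IPMap

lemma IsComplementedIn.range_tensorId {S : IPMap X Y} (h : IsComplementedIn S.range ⊤)
    (M : Correspondence.{u, v} A) : IsComplementedIn (S.tensorId M).range ⊤ := by
  have hclosed := (S.tensorId M).isClosedSubmodule_range
  refine isComplementedIn_iff.mpr ⟨hclosed, isClosedSubmodule_top, le_top, top_le_iff.mpr <|
    eq_top_of_tmul_mem (isClosed_sup_perp hclosed.isClosed) fun y m => ?_⟩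
  obtain ⟨_, ⟨x, rfl⟩, n, hn, rfl⟩ := Submodule.mem_sup.mp (h.le_sup_perp (x := y) trivial)
  rw [tmul_add_left]
  exact Submodule.add_mem_sup ⟨tmul x m, S.tensorId_tmul M x m⟩
    (S.tmul_mem_perp_range_tensorId hn m)

end Tensor

section Powers

variable {A : Type u} [NonUnitalCStarAlgebra A] [PartialOrder A] [StarOrderedRing A]
  {X Y : HilbertModule.{u, v} A} {M : Correspondence.{u, v} A}

namespace IPMap

lemma subTpow_range (S : IPMap X Y) (M : Correspondence.{u, v} A) (k : ℕ) :
    Y.subTpow S.range M k = (S.tpow M k).range := by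
  induction k with
  | zero => rfl
  | succ k ih =>
    rw [HilbertModule.subTpow, ih]
    exact ((S.tpow M k).range_tensorId M).symm

lemma tpow_succ_comp_amp {S : IPMap Y X} {T : IPMap Y (Y.tensor M)} {D : IPMap X (X.tensor M)}
    (h : (S.tensorId M).comp T = D.comp S) (k : ℕ) :
    (S.tpow M (k + 1)).comp (T.amp k) = (D.amp k).comp (S.tpow M k) := by
  induction k with
  | zero => exact h
  | succ k ih =>
    calc ((S.tpow M (k + 1)).tensorId M).comp ((T.amp k).tensorId M)
        = ((D.amp k).comp (S.tpow M k)).tensorId M := by rw [← tensorId_comp, ih]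
      _ = ((D.amp k).tensorId M).comp ((S.tpow M k).tensorId M) := tensorId_comp ..

end IPMap

lemma IsComplementedIn.range_amp {T : IPMap X (X.tensor M)} (h : IsComplementedIn T.range ⊤)
    (k : ℕ) : IsComplementedIn (T.amp k).range ⊤ := by
  induction k with
  | zero => exact h
  | succ k ih => exact ih.range_tensorId M

namespace HilbertIso

lemma toIPMap_amp (U : HilbertIso X (X.tensor M)) (k : ℕ) :
    (U.amp k).toIPMap = U.toIPMap.amp k := by
  induction k with
  | zero => rfl
  | succ k ih => exact congrArg (IPMap.tensorId · M) ih

lemma pow_succ (U : HilbertIso X (X.tensor M)) (k : ℕ) :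
    U.pow (k + 1) = U.trans ((U.pow k).tensorId M) := by
  apply ext
  induction k with
  | zero =>
    change U.toIPMap = ((IPMap.id X).tensorId M).comp U.toIPMap
    rw [IPMap.tensorId_id, IPMap.id_comp]
  | succ k ih =>
    calc ((U.amp k).toIPMap.tensorId M).comp (U.pow (k + 1)).toIPMap
        = (((U.amp k).toIPMap.tensorId M).comp ((U.pow k).toIPMap.tensorId M)).comp U.toIPMap :=
          congrArg _ ih
      _ = (((U.amp k).toIPMap.comp (U.pow k).toIPMap).tensorId M).comp U.toIPMap := by
          rw [IPMap.tensorId_comp]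

lemma symm_pow_succ (U : HilbertIso X (X.tensor M)) (k : ℕ) :
    (U.pow (k + 1)).symm.toIPMap
      = U.symm.toIPMap.comp ((U.pow k).symm.toIPMap.tensorId M) := by
  rw [pow_succ]
  rfl

end HilbertIso

end Powers

section DirectLimits

variable {A : Type u} [NonUnitalCStarAlgebra A] [PartialOrder A]
  {X : ℕ → HilbertModule.{u, v} A} (T : ∀ k, IPMap (X k) (X (k + 1)))

namespace IPMap

/-- The composition `T (j - 1) ∘ ⋯ ∘ T i` of consecutive maps of a sequence of Hilbert modules. -/
def transition {i j : ℕ} (h : i ≤ j) : IPMap (X i) (X j) :=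
  Nat.leRecOn h (fun {k} S => (T k).comp S) (id (X i))

lemma transition_self (i : ℕ) : transition T (le_refl i) = id (X i) :=
  Nat.leRecOn_self _

lemma transition_succ {i j : ℕ} (h : i ≤ j) :
    transition T (h.trans j.le_succ) = (T j).comp (transition T h) :=
  Nat.leRecOn_succ h _

lemma transition_trans {i j k : ℕ} (h : i ≤ j) (h' : j ≤ k) :
    (transition T h').comp (transition T h) = transition T (h.trans h') := by
  induction k, h' using Nat.le_induction with
  | base => rw [transition_self, id_comp]
  | succ k h' ih => rw [transition_succ T h', comp_assoc, ih, ← transition_succ]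

variable {T} in
lemma apply_transition {Z : Type*} {S : ∀ k, X k → Z} (hS : ∀ k x, S (k + 1) (T k x) = S k x)
    {i j : ℕ} (h : i ≤ j) (x : X i) : S j (transition T h x) = S i x := by
  induction j, h using Nat.le_induction with
  | base => rw [transition_self]; rfl
  | succ j h ih => rw [transition_succ T h, comp_apply, hS, ih]

instance : DirectedSystem (fun k => (X k : Type v)) fun _ _ h => transition T h where
  map_self _ x := congr_fun (transition_self T _) x
  map_map _ _ _ h h' x := congr_fun (transition_trans T h h') x

/-- The direct limit of the sequence as a complex vector space, before completion. -/
abbrev AlgLimit : Type v :=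
  _root_.DirectLimit (fun k => (X k : Type v)) fun _ _ h => (transition T h).toLinearMap

namespace AlgLimit

/-- The canonical map of `X k` into the algebraic direct limit. -/
def of (k : ℕ) : X k →ₗ[ℂ] AlgLimit T :=
  DirectLimit.Module.of ℂ ℕ _ (fun _ _ h => (transition T h).toLinearMap) k

lemma of_succ (k : ℕ) (x : X k) : of T (k + 1) (T k x) = of T k x := by
  have h : transition T k.le_succ = T k := by
    rw [transition_succ T le_rfl, transition_self, comp_id]
  rw [← h]
  exact DirectLimit.Module.of_f

variable {T} in
/-- The linear map on the algebraic direct limit given by compatible linear maps. -/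
def lift {E : Type*} [AddCommGroup E] [Module ℂ E] (S : ∀ k, X k →ₗ[ℂ] E)
    (hS : ∀ k x, S (k + 1) (T k x) = S k x) : AlgLimit T →ₗ[ℂ] E :=
  DirectLimit.Module.lift ℂ ℕ _ _ S fun _ _ h x =>
    apply_transition (S := fun k => S k) hS h x

end AlgLimit

end IPMap

namespace HilbertModule

/-- The semi-inner product on the algebraic direct limit induced by those of the `X k`. -/
def preLimit : PreHilbert A (IPMap.AlgLimit T) where
  form := DirectLimit.lift₂ _ _ (fun _ x y => ip x y) fun _ _ h x y =>
    ((IPMap.transition T h).ip_map x y).symm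
  act a := IPMap.AlgLimit.lift (fun k => IPMap.AlgLimit.of T k ∘ₗ ractₗ (X k) a) fun k x =>
    (congrArg _ ((T k).map_ract x a).symm).trans (IPMap.AlgLimit.of_succ T k (ract x a))
  form_add_right := DirectLimit.induction₃ _ fun k x y z => by
    simp only [DirectLimit.add_def, DirectLimit.lift₂_def, ip_add_right]
  form_smul_right c := DirectLimit.induction₂ _ fun k x y => by
    simp only [DirectLimit.smul_def, DirectLimit.lift₂_def, ip_smul_right]
  star_form := DirectLimit.induction₂ _ fun k x y => by
    simp only [DirectLimit.lift₂_def, star_ip]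
  form_self_nonneg := DirectLimit.induction _ fun k x => by
    simp only [DirectLimit.lift₂_def, ip_self_nonneg]
  form_act a := DirectLimit.induction₂ _ fun k x y => by
    rw [DirectLimit.lift₂_def, ← ip_ract_right]
    exact DirectLimit.lift₂_def ..

lemma preLimit_form_of (k : ℕ) (x y : X k) :
    (preLimit T).form (IPMap.AlgLimit.of T k x) (IPMap.AlgLimit.of T k y) = ip x y :=
  DirectLimit.lift₂_def (fun _ _ h => (IPMap.transition T h).toLinearMap)
    (fun _ _ h => (IPMap.transition T h).toLinearMap) (fun _ x y => ip x y)
    (fun _ _ h x y => ((IPMap.transition T h).ip_map x y).symm) k x y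

variable [StarOrderedRing A]

/-- The Hilbert module obtained by completing the algebraic direct limit. -/
def limit : HilbertModule.{u, v} A :=
  (preLimit T).completion

/-- The canonical map of `X k` into the completed direct limit. -/
def toLimit (k : ℕ) : IPMap (X k) (limit T) where
  toLinearMap := UniformSpace.Completion.toComplₗᵢ.toLinearMap ∘ₗ
    (preLimit T).toSpace.toLinearMap ∘ₗ IPMap.AlgLimit.of T k
  ip_map x y :=
    (congrArg unop ((preLimit T).inner_coe _ _)).trans (preLimit_form_of T k x y)

end HilbertModule

section Cocone

variable {T} {L L' Z : HilbertModule.{u, v} A} {ι : ∀ k, IPMap (X k) L} {κ : ∀ k, IPMap (X k) L'}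

/-- The maps `ι k` are compatible with the sequence, and the union of their ranges is dense in `L`.
By `isDirectLimit_iff` this characterises the direct limit without quantifying over
all Hilbert modules. -/
structure IsDenseCocone (T : ∀ k, IPMap (X k) (X (k + 1))) (ι : ∀ k, IPMap (X k) L) : Prop where
  compat : ∀ (k : ℕ) (x : X k), ι (k + 1) (T k x) = ι k x
  dense : Dense (⋃ k, ((ι k).range : Set L))

namespace IsDenseCocone

lemma comp_eq (h : IsDenseCocone T ι) (k : ℕ) : (ι (k + 1)).comp (T k) = ι k :=
  IPMap.ext (h.compat k)

lemma range_le_succ (h : IsDenseCocone T ι) (k : ℕ) : (ι k).range ≤ (ι (k + 1)).range := by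
  rintro _ ⟨x, rfl⟩
  exact ⟨T k x, h.compat k x⟩

lemma induction (h : IsDenseCocone T ι) {p : L → Prop} (hp : IsClosed {z | p z})
    (hι : ∀ k x, p (ι k x)) (z : L) : p z := by
  refine closure_minimal (Set.iUnion_subset fun k => ?_) hp (h.dense z)
  rintro _ ⟨x, rfl⟩
  exact hι k x

lemma ext (h : IsDenseCocone T ι) {S S' : IPMap L Z} (hS : ∀ k, S.comp (ι k) = S'.comp (ι k)) :
    S = S' :=
  IPMap.ext <| h.induction (isClosed_eq S.continuous S'.continuous) fun k x =>
    IPMap.congr_fun (hS k) x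

lemma denseRange_lift (h : IsDenseCocone T ι) :
    DenseRange (IPMap.AlgLimit.lift (fun k => (ι k).toLinearMap) h.compat) := by
  refine h.dense.mono (Set.iUnion_subset fun k => ?_)
  rintro _ ⟨x, rfl⟩
  exact ⟨IPMap.AlgLimit.of T k x, rfl⟩

lemma exists_desc (h : IsDenseCocone T ι) {S : ∀ k, X k →L[ℂ] Z} {C : ℝ}
    (hST : ∀ k x, S (k + 1) (T k x) = S k x) (hC : ∀ k, ‖S k‖ ≤ C) :
    ∃ S' : L →L[ℂ] Z, ‖S'‖ ≤ C ∧ ∀ k x, S' (ι k x) = S k x := by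
  let s := IPMap.AlgLimit.lift (fun k => (S k).toLinearMap) hST
  let e := IPMap.AlgLimit.lift (fun k => (ι k).toLinearMap) h.compat
  have hse : ∀ z, ‖s z‖ ≤ C * ‖e z‖ := DirectLimit.induction _ fun k x =>
    ((S k).le_of_opNorm_le (hC k) x).trans_eq (congrArg (C * ·) ((ι k).norm_map x).symm)
  exact ⟨s.extendOfNorm e,
    LinearMap.opNorm_extendOfNorm_le h.denseRange_lift ((norm_nonneg _).trans (hC 0)) hse,
    fun k x => LinearMap.extendOfNorm_eq h.denseRange_lift ⟨C, hse⟩ (IPMap.AlgLimit.of T k x)⟩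

lemma isDirectLimit (h : IsDenseCocone T ι) : IsDirectLimit X T L ι where
  compat := h.compat
  universal Z S C hSA hST hC := by
    obtain ⟨S', hS'C, hS'⟩ := h.exists_desc hST hC
    refine ⟨S', ⟨fun z a => ?_, hS'C, hS'⟩, fun S'' ⟨_, _, hS''⟩ => ?_⟩
    · refine h.induction (isClosed_eq (S'.continuous.comp (continuous_ract a))
        ((continuous_ract a).comp S'.continuous)) (fun k x => ?_) z
      change S' (ract (ι k x) a) = ract (S' (ι k x)) a
      rw [← (ι k).map_ract, hS', hS', hSA]
    · exact ContinuousLinearMap.ext <| h.induction (isClosed_eq S''.continuous S'.continuous)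
        fun k x => (hS'' k x).trans (hS' k x).symm

lemma shift (h : IsDenseCocone T ι) :
    IsDenseCocone (fun k => T (k + 1)) fun k => ι (k + 1) where
  compat k := h.compat (k + 1)
  dense := h.dense.mono <| Set.iUnion_mono fun k => h.range_le_succ k

lemma isComplementedIn_range_succ (h : IsDenseCocone T ι)
    (hT : ∀ k, IsComplementedIn (T k).range ⊤) (k : ℕ) :
    IsComplementedIn (ι k).range (ι (k + 1)).range := by
  have hk := (hT k).map (ι (k + 1))
  rwa [← IPMap.range_comp, ← IPMap.range_eq_map, h.comp_eq] at hk

variable [StarOrderedRing A]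

lemma exists_descIPMap (h : IsDenseCocone T ι) {S : ∀ k, IPMap (X k) Z}
    (hST : ∀ k x, S (k + 1) (T k x) = S k x) : ∃ S' : IPMap L Z, ∀ k, S'.comp (ι k) = S k := by
  obtain ⟨S', -, hS'⟩ := h.exists_desc (S := fun k => (S k).toCLM) hST fun k =>
    (S k).norm_toCLM_le
  refine ⟨⟨S', fun z w => h.denseRange_lift.induction_on₂
    (p := fun z w => ip (S' z) (S' w) = ip z w) ?_ (DirectLimit.induction₂ _ fun k x y => ?_) z w⟩,
    fun k => IPMap.ext (hS' k)⟩
  · exact isClosed_eq (continuous_ip.comp (S'.continuous.prodMap S'.continuous)) continuous_ip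
  · change ip (S' (ι k x)) (S' (ι k y)) = ip (ι k x) (ι k y)
    rw [hS', hS', (ι k).ip_map]
    exact (S k).ip_map x y

lemma exists_iso (h : IsDenseCocone T ι) (h' : IsDenseCocone T κ) :
    ∃ U : HilbertIso L L', ∀ k, U.toIPMap.comp (ι k) = κ k := by
  obtain ⟨S, hS⟩ := h.exists_descIPMap h'.compat
  obtain ⟨S', hS'⟩ := h'.exists_descIPMap h.compat
  refine ⟨.ofIPMap S S' (h'.ext fun k => ?_) (h.ext fun k => ?_), hS⟩
  · rw [IPMap.comp_assoc, hS', hS, IPMap.id_comp]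
  · rw [IPMap.comp_assoc, hS, hS', IPMap.id_comp]

end IsDenseCocone

variable [StarOrderedRing A]

lemma isDenseCocone_toLimit (T : ∀ k, IPMap (X k) (X (k + 1))) : IsDenseCocone T (toLimit T) where
  compat k x := congrArg (fun z => (((preLimit T).toSpace z : (preLimit T).Space) :
    (preLimit T).Compl)) (IPMap.AlgLimit.of_succ T k x)
  dense := by
    refine (UniformSpace.Completion.denseRange_coe (α := (preLimit T).Space)).mono ?_
    rintro _ ⟨z, rfl⟩
    induction z using DirectLimit.induction with
    | _ k x => exact Set.mem_iUnion.mpr ⟨k, x, rfl⟩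

lemma isDirectLimit_iff : IsDirectLimit X T L ι ↔ IsDenseCocone T ι := by
  refine ⟨fun h => ⟨h.compat, fun z => ?_⟩, IsDenseCocone.isDirectLimit⟩
  have hlim := isDenseCocone_toLimit T
  obtain ⟨G, hG⟩ := hlim.exists_descIPMap h.compat
  obtain ⟨F, ⟨hFA, hFnorm, hF⟩, -⟩ := h.universal (limit T) (fun k => (toLimit T k).toCLM) 1
    (fun k => (toLimit T k).map_ract) hlim.compat fun k => (toLimit T k).norm_toCLM_le
  have hGF : G.toCLM ∘L F = .id ℂ L := by
    refine (h.universal L (fun k => (ι k).toCLM) 1 (fun k => (ι k).map_ract) h.compat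
      fun k => (ι k).norm_toCLM_le).unique ⟨fun z a => ?_, ?_, fun k x => ?_⟩
      ⟨fun _ _ => rfl, ContinuousLinearMap.norm_id_le, fun _ _ => rfl⟩
    · exact (congrArg G (hFA z a)).trans (G.map_ract _ a)
    · exact (G.toCLM.opNorm_comp_le F).trans
        (mul_le_one₀ G.norm_toCLM_le (norm_nonneg F) hFnorm)
    · exact (congrArg G (hF k x)).trans (IPMap.congr_fun (hG k) x)
  rw [← show G (F z) = z from DFunLike.congr_fun hGF z]
  refine hlim.induction (p := fun w => G w ∈ closure (⋃ k, ((ι k).range : Set L)))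
    (isClosed_closure.preimage G.continuous) (fun k x => subset_closure ?_) (F z)
  exact Set.mem_iUnion.mpr ⟨k, x, (IPMap.congr_fun (hG k) x).symm⟩

namespace IsDenseCocone

lemma tensorId (h : IsDenseCocone T ι) (M : Correspondence.{u, v} A) :
    IsDenseCocone (fun k => (T k).tensorId M) fun k => (ι k).tensorId M := by
  have hcompat (k : ℕ) : ((ι (k + 1)).tensorId M).comp ((T k).tensorId M) = (ι k).tensorId M := by
    rw [← IPMap.tensorId_comp, h.comp_eq]
  have hmono : Monotone fun k => ((ι k).tensorId M).range :=
    monotone_nat_of_le_succ fun k => by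
      rw [← hcompat k, IPMap.range_comp]
      exact LinearMap.map_le_range
  refine ⟨fun k => IPMap.congr_fun (hcompat k), ?_⟩
  rw [← Submodule.coe_iSup_of_directed _ hmono.directed_le,
    Submodule.dense_iff_topologicalClosure_eq_top]
  have hclosed := (⨆ k, ((ι k).tensorId M).range).isClosed_topologicalClosure
  refine eq_top_of_tmul_mem hclosed fun z m =>
    h.induction (hclosed.preimage (continuous_tmul_left m)) (fun k x => ?_) z
  refine Submodule.le_topologicalClosure _ (Submodule.mem_iSup_of_mem k ?_)
  exact ⟨tmul x m, (ι k).tensorId_tmul M x m⟩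

lemma isComplementedIn_range_top (h : IsDenseCocone T ι)
    (hT : ∀ k, IsComplementedIn (T k).range ⊤) (k : ℕ) : IsComplementedIn (ι k).range ⊤ := by
  have hclosed := (ι k).isClosedSubmodule_range
  have hle {j : ℕ} (hkj : k ≤ j) : IsComplementedIn (ι k).range (ι j).range := by
    induction j, hkj using Nat.le_induction with
    | base => exact hclosed.isComplementedIn_self
    | succ j _ ih => exact ih.trans (h.isComplementedIn_range_succ hT j)
  have hmono : Monotone fun j => (ι j).range := monotone_nat_of_le_succ h.range_le_succ
  refine isComplementedIn_iff.mpr ⟨hclosed, isClosedSubmodule_top, le_top, fun z _ =>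
    h.induction (isClosed_sup_perp hclosed.isClosed) (fun j x => ?_) z⟩
  exact (hle (le_max_left k j)).le_sup_perp (hmono (le_max_right k j) ⟨x, rfl⟩)

end IsDenseCocone

end Cocone

end DirectLimits

section MultiResolution

variable {A : Type u} [NonUnitalCStarAlgebra A] [PartialOrder A] [StarOrderedRing A]
  {M : Correspondence.{u, v} A} {X Y L : HilbertModule.{u, v} A}
  {T : IPMap Y (Y.tensor M)} {ι : ∀ k, IPMap (Y.tpow M k) L}
  {R : HilbertIso L (L.tensor M)} {D : HilbertIso X (X.tensor M)}

lemma IsDenseCocone.exists_iso_tensor (h : IsDenseCocone T.amp ι) :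
    ∃ R : HilbertIso L (L.tensor M), ∀ k, R.toIPMap.comp (ι (k + 1)) = (ι k).tensorId M :=
  h.shift.exists_iso (h.tensorId M)

lemma HilbertIso.symm_pow_succ_comp_tpow (D : HilbertIso X (X.tensor M)) (S : IPMap Y X) (k : ℕ) :
    (D.pow (k + 1)).symm.toIPMap.comp (S.tpow M (k + 1))
      = D.symm.toIPMap.comp (((D.pow k).symm.toIPMap.comp (S.tpow M k)).tensorId M) := by
  rw [symm_pow_succ, IPMap.tensorId_comp]
  rfl

lemma IPMap.comp_eq_symm_comp_tensorId {Q : IPMap L X} {κ : IPMap Y L}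
    {κ' : IPMap (Y.tensor M) L} (hκ : R.toIPMap.comp κ' = κ.tensorId M)
    (hQ : D.toIPMap.comp Q = (Q.tensorId M).comp R.toIPMap) :
    Q.comp κ' = D.symm.toIPMap.comp ((Q.comp κ).tensorId M) := by
  rw [eq_comm, HilbertIso.symm_comp_eq_iff, tensorId_comp, ← hκ, ← comp_assoc, hQ, comp_assoc]

lemma IPMap.comp_eq_symm_pow_comp_tpow {Q : IPMap L X} {S : IPMap Y X} (hS : Q.comp (ι 0) = S)
    (hR : ∀ k, R.toIPMap.comp (ι (k + 1)) = (ι k).tensorId M)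
    (hQ : D.toIPMap.comp Q = (Q.tensorId M).comp R.toIPMap) (k : ℕ) :
    Q.comp (ι k) = (D.pow k).symm.toIPMap.comp (S.tpow M k) := by
  induction k with
  | zero => exact hS
  | succ k ih =>
    rw [D.symm_pow_succ_comp_tpow, ← ih]
    exact comp_eq_symm_comp_tensorId (hR k) hQ

lemma IsDenseCocone.exists_intertwiner (h : IsDenseCocone T.amp ι)
    (hR : ∀ k, R.toIPMap.comp (ι (k + 1)) = (ι k).tensorId M) {S : IPMap Y X}
    (hS : D.toIPMap.comp S = (S.tensorId M).comp T) :
    ∃ Q : IPMap L X, Q.comp (ι 0) = S ∧ D.toIPMap.comp Q = (Q.tensorId M).comp R.toIPMap := by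
  let S' (k : ℕ) : IPMap (Y.tpow M k) X := (D.pow k).symm.toIPMap.comp (S.tpow M k)
  have hS' (k : ℕ) : (S' (k + 1)).comp (T.amp k) = S' k := by
    rw [IPMap.comp_assoc, IPMap.tpow_succ_comp_amp hS.symm, ← D.toIPMap_amp]
    exact congrArg ((D.pow k).symm.toIPMap.comp <| ·.comp (S.tpow M k)) (D.amp k).symm_comp
  obtain ⟨Q, hQ⟩ := h.exists_descIPMap (S := S') fun k => IPMap.congr_fun (hS' k)
  refine ⟨Q, hQ 0, h.shift.ext fun k => ?_⟩
  have hDS' : D.toIPMap.comp (S' (k + 1)) = (S' k).tensorId M :=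
    HilbertIso.symm_comp_eq_iff.mp (D.symm_pow_succ_comp_tpow S k).symm
  rw [IPMap.comp_assoc, IPMap.comp_assoc, hR, hQ, hDS', ← hQ]
  exact Q.tensorId_comp (ι k) M

lemma IsDenseCocone.isProjectiveMRA_range (h : IsDenseCocone T.amp ι)
    (hT : IsComplementedIn T.range ⊤) (hR : ∀ k, R.toIPMap.comp (ι (k + 1)) = (ι k).tensorId M)
    {Q : IPMap L X} (hQ : D.toIPMap.comp Q = (Q.tensorId M).comp R.toIPMap) :
    IsProjectiveMRA D Q.range fun k => (ι k).range.map Q.toLinearMap where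
  complemented_zero := by
    rw [Q.range_eq_map]
    exact (h.isComplementedIn_range_top hT.range_amp 0).map Q
  eq_pow_symm k := by
    let S : IPMap Y X := Q.comp (ι 0)
    have hk : Q.comp (ι k) = (D.pow k).symm.toIPMap.comp (S.tpow M k) :=
      IPMap.comp_eq_symm_pow_comp_tpow rfl hR hQ k
    have h₀ : (ι 0).range.map Q.toLinearMap = S.range := (IPMap.range_comp Q (ι 0)).symm
    rw [h₀, ← IPMap.range_comp, hk, IPMap.range_comp, IPMap.subTpow_range]
    rfl
  complemented_succ k := (h.isComplementedIn_range_succ hT.range_amp k).map Q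
  le k := LinearMap.map_le_range
  dense := by
    rintro _ ⟨z, rfl⟩
    refine h.induction (isClosed_closure.preimage Q.continuous) (fun k x => subset_closure ?_) z
    exact Set.mem_iUnion.mpr ⟨k, ι k x, ⟨x, rfl⟩, rfl⟩

lemma IsDenseCocone.isProjectiveMRA_top (h : IsDenseCocone T.amp ι)
    (hT : IsComplementedIn T.range ⊤) (hR : ∀ k, R.toIPMap.comp (ι (k + 1)) = (ι k).tensorId M) :
    IsProjectiveMRA R ⊤ fun k => (ι k).range := by
  have hid : R.toIPMap.comp (.id L) = ((IPMap.id L).tensorId M).comp R.toIPMap := by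
    rw [IPMap.tensorId_id, IPMap.id_comp, IPMap.comp_id]
  convert h.isProjectiveMRA_range hT hR hid using 2 with k
  · exact LinearMap.range_id.symm
  · exact (Submodule.map_id _).symm

end MultiResolution

end

theorem mainTheorem1 {A : Type u} [NonUnitalCStarAlgebra A] [PartialOrder A]
    [StarOrderedRing A] (M : Correspondence.{u, v} A) (Y : HilbertModule.{u, v} A)
    (T : IPMap Y (Y.tensor M)) (hT : T.IsAdjointable) :
    (∃ (L : HilbertModule.{u, v} A) (ι : ∀ k, IPMap (Y.tpow M k) L),
      IsDirectLimit (Y.tpow M) T.amp L ι) ∧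
    ∀ (L : HilbertModule.{u, v} A) (ι : ∀ k, IPMap (Y.tpow M k) L),
      IsDirectLimit (Y.tpow M) T.amp L ι →
      ∃ R : HilbertIso L (L.tensor M),
        (∀ (k : ℕ) (y : Y.tpow M (k + 1)), R (ι (k + 1) y) = (ι k).tensorId M y) ∧
        IsProjectiveMRA R ⊤ (fun k => (ι k).range) ∧
        ∀ (X : HilbertModule.{u, v} A) (D : HilbertIso X (X.tensor M)) (Q₀ : IPMap Y X),
          (∀ y : Y, D (Q₀ y) = Q₀.tensorId M (T y)) →
          ∃ Q : IPMap L X,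
            (∀ y : Y, Q (ι 0 y) = Q₀ y) ∧
            (∀ z : L, D (Q z) = Q.tensorId M (R z)) ∧
            (∀ k : ℕ, (((ι k).range.map Q.toLinearMap : Submodule ℂ X) : Set X)
              = Set.range fun y : Y.tpow M k => (D.pow k).symm (Q₀.tpow M k y)) ∧
            IsProjectiveMRA D Q.range (fun k => (ι k).range.map Q.toLinearMap) := by
  have hT' : IsComplementedIn T.range ⊤ := hT.isComplementedIn_range
  refine ⟨⟨_, _, (isDenseCocone_toLimit T.amp).isDirectLimit⟩, fun L ι hι => ?_⟩
  have h : IsDenseCocone T.amp ι := isDirectLimit_iff.mp hι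
  obtain ⟨R, hR⟩ := h.exists_iso_tensor
  refine ⟨R, fun k => IPMap.congr_fun (hR k), h.isProjectiveMRA_top hT' hR, fun X D Q₀ hQ₀ => ?_⟩
  obtain ⟨Q, hQ, hDQ⟩ := h.exists_intertwiner hR (S := Q₀) (D := D) (IPMap.ext hQ₀)
  refine ⟨Q, IPMap.congr_fun hQ, IPMap.congr_fun hDQ, fun k => ?_,
    h.isProjectiveMRA_range hT' hR hDQ⟩
  rw [← IPMap.range_comp, IPMap.comp_eq_symm_pow_comp_tpow hQ hR hDQ]
  exact LinearMap.coe_range _
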